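/- Logarithms are to base 2. Fix a real $c>1$ and put $d=d(n)=\lfloor c\log n\rfloor$. In the \emph{OV indexing} problem a set $S\subseteq\{0,1\}^d$ of $n$ vectors is preprocessed, and a query $u\in\{0,1\}^d$ asks whether some $v\in S$ is orthogonal to $u$, i.e. $\sum_i u_iv_i=0$. Here $f=\tilde O(g)$ means that $f(n)=O(g(n)\,n^{\eta})$ for every $\eta>0$. Let $c_1$ be the supremum of the set $X$ of all $x$ with $0<x\le c/2$ such that $\binom{\lfloor c\log n\rfloor}{\lfloor x\log n\rfloor}=\tilde O(n^{1-\delta})$ for some $\delta>0$. \textbf{DivideByOnes.} The data structure with integer parameters $t,b,m_1,m_2,L$ stores: (i) the list of all $v\in S$ with at most $t$ ones; (ii) for every set $J$ of $m_2$ among the first $m_1$ consecutive blocks of $b$ coordinates, an array $A_J$ indexed by the bit patterns $a$ on the coordinates in $J$. Every $v\in S$ with more than $t$ ones is assigned to one set $J$ in which it has the maximum number of ones (ties are broken arbitrarily). The entry $A_J[a]$ points to the list of all vectors assigned to $J$ that are orthogonal to $a$ on the coordinates in $J$ if this list has at most $L$ elements; otherwise it points to a bitmap that tells, for every pattern $r$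 on the remaining coordinates, whether some vector in $S$ is orthogonal to the vector composed of $a$ and $r$. \textbf{Theorem.} Let $0<\varepsilon\le\max(c_1,c-1)$. Then DivideByOnes solves OV indexing with truly sublinear query time using $$O\!\left(n^{\,c-\frac{c_1-\varepsilon}{c}(c-1-\varepsilon)}\right)$$ bits of space. Precisely, there are $x\in X$, $\eta>0$, $\gamma>0$, $\delta>0$, constants $C$ and $K$, and a word-RAM program $P$, all depending only on $c$ and $\varepsilon$, such that for every $n\ge1$ and every $S\subseteq\{0,1\}^{d}$ with $|S|=n$ there is a memory content of words of $K(\lfloor\log n\rfloor+1)$ bits each with the following properties. It contains the DivideByOnes data structure for $S$ with $t=\lfloor x\log n\rfloor$, $b=\lfloor\eta\log n\rfloor$, $m_1=\lfloor c/\eta\rfloor$, $m_2=\lfloor (c-1)/\eta\rfloor$, $L=\lfloor n^{1-\gamma}\rfloor$; its total size, working memory included, is at most $C\,n^{c-\frac{c_1-\varepsilon}{c}(c-1-\varepsilon)}$ bits; and for every query $u\in\{0,1\}^d$, the program $P$, started on this memory with $u$ in a register, halts after at most $C\,n^{1-\delta}$ steps and correctly reports whether some $v\in S$ is orthogonal to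 $u$. -/

import Mathlib

open Filter Asymptotics

/-! ### The word RAM

Words have `w` bits, and every arithmetic operation acts on words (modulo `2 ^ w`). A machine has
a memory of a fixed number `s` of words and registers numbered by `ℕ`, of which a program can use
only the finitely many that it mentions. -/

namespace WordRAM

/-- The binary operations of the machine. -/
inductive Op where
  | add | sub | mul | div | mod | and | or | xor | shl | shr | eq | lt

/-- The value of a binary operation; comparisons return the word `1` or `0`. -/
def Op.eval {w : ℕ} : Op → BitVec w → BitVec w → BitVec w
  | .add, x, y => x + y
  | .sub, x, y => x - y
  | .mul, x, y => x * y
  | .div, x, y => x / y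
  | .mod, x, y => x % y
  | .and, x, y => x &&& y
  | .or, x, y => x ||| y
  | .xor, x, y => x ^^^ y
  | .shl, x, y => x <<< y.toNat
  | .shr, x, y => x >>> y.toNat
  | .eq, x, y => if x = y then 1 else 0
  | .lt, x, y => if x.toNat < y.toNat then 1 else 0

/-- Expressions: numerals, registers, indirect memory reads, binary operations. -/
inductive Expr where
  | lit (k : ℕ)
  | reg (r : ℕ)
  | load (addr : Expr)
  | bin (op : Op) (e₁ e₂ : Expr)

/-- Programs. They are fixed finite objects that do not depend on the word length. -/
inductive Cmd where
  | skip
  | assign (r : ℕ) (e : Expr)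
  | store (addr e : Expr)
  | seq (P Q : Cmd)
  | ite (e : Expr) (P Q : Cmd)
  | while (e : Expr) (P : Cmd)

/-- The state of a machine with `s` memory cells of `w` bits each. -/
structure State (w s : ℕ) where
  reg : ℕ → BitVec w
  mem : Fin s → BitVec w

/-- The value of an expression; a read outside the memory returns `0`. -/
def Expr.eval {w s : ℕ} (σ : State w s) : Expr → BitVec w
  | .lit k => BitVec.ofNat w k
  | .reg r => σ.reg r
  | .load e => if h : (e.eval σ).toNat < s then σ.mem ⟨(e.eval σ).toNat, h⟩ else 0
  | .bin op e₁ e₂ => op.eval (e₁.eval σ) (e₂.eval σ)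

/-- The number of elementary steps that evaluating an expression takes: one for each numeral,
register access, memory read and word operation. -/
def Expr.cost : Expr → ℕ
  | .lit _ => 1
  | .reg _ => 1
  | .load e => e.cost + 1
  | .bin _ e₁ e₂ => e₁.cost + e₂.cost + 1

def State.setReg {w s : ℕ} (σ : State w s) (r : ℕ) (x : BitVec w) : State w s :=
  { σ with reg := Function.update σ.reg r x }

/-- Writing to a memory cell; a write outside the memory has no effect. -/
def State.setMem {w s : ℕ} (σ : State w s) (a x : BitVec w) : State w s :=
  if h : a.toNat < s then { σ with mem := Function.update σ.mem ⟨a.toNat, h⟩ x } else σ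

/-- `Exec P σ σ' T`: started in the state `σ`, the program `P` halts in the state `σ'` after
exactly `T` elementary steps. -/
inductive Exec {w s : ℕ} : Cmd → State w s → State w s → ℕ → Prop
  | skip (σ : State w s) : Exec .skip σ σ 1
  | assign (r : ℕ) (e : Expr) (σ : State w s) :
      Exec (.assign r e) σ (σ.setReg r (e.eval σ)) (e.cost + 1)
  | store (a e : Expr) (σ : State w s) :
      Exec (.store a e) σ (σ.setMem (a.eval σ) (e.eval σ)) (a.cost + e.cost + 1)
  | seq {P Q : Cmd} {σ₁ σ₂ σ₃ : State w s} {T₁ T₂ : ℕ} :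
      Exec P σ₁ σ₂ T₁ → Exec Q σ₂ σ₃ T₂ → Exec (.seq P Q) σ₁ σ₃ (T₁ + T₂)
  | iteTrue {e : Expr} {P Q : Cmd} {σ σ' : State w s} {T : ℕ} :
      e.eval σ ≠ 0 → Exec P σ σ' T → Exec (.ite e P Q) σ σ' (e.cost + 1 + T)
  | iteFalse {e : Expr} {P Q : Cmd} {σ σ' : State w s} {T : ℕ} :
      e.eval σ = 0 → Exec Q σ σ' T → Exec (.ite e P Q) σ σ' (e.cost + 1 + T)
  | whileTrue {e : Expr} {P : Cmd} {σ₁ σ₂ σ₃ : State w s} {T₁ T₂ : ℕ} :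
      e.eval σ₁ ≠ 0 → Exec P σ₁ σ₂ T₁ → Exec (.while e P) σ₂ σ₃ T₂ →
        Exec (.while e P) σ₁ σ₃ (e.cost + 1 + T₁ + T₂)
  | whileFalse {e : Expr} {P : Cmd} {σ : State w s} :
      e.eval σ = 0 → Exec (.while e P) σ σ (e.cost + 1)

/-- The word length `K (⌊log₂ n⌋ + 1) = Θ(log n)` used for inputs of size `n`. -/
def wordSize (K n : ℕ) : ℕ := K * (Nat.log 2 n + 1)

end WordRAM

/-! ### Boolean vectors -/

namespace OVIndexing

/-- Boolean vectors of length `d`. -/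
abbrev Vec (d : ℕ) := Fin d → Bool

/-- The inner product of `u` and `v` over the coordinates in `W`. -/
def innerOn {d : ℕ} (W : Finset (Fin d)) (u v : Vec d) : ℕ :=
  ∑ i ∈ W, (u i).toNat * (v i).toNat

/-- Two boolean vectors are orthogonal if their inner product is zero. -/
def Orthogonal {d : ℕ} (u v : Vec d) : Prop := innerOn Finset.univ u v = 0

/-- The number of ones of `v` in the coordinates in `W`. -/
def onesOn {d : ℕ} (W : Finset (Fin d)) (v : Vec d) : ℕ := ∑ i ∈ W, (v i).toNat

/-- The number of ones of `v`. -/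
def ones {d : ℕ} (v : Vec d) : ℕ := onesOn Finset.univ v

/-- The word whose bits are the coordinates of `v` (for `d ≤ w`). -/
def encode {d : ℕ} (w : ℕ) (v : Vec d) : BitVec w :=
  BitVec.ofNat w (∑ i : Fin d, (v i).toNat * 2 ^ (i : ℕ))

/-- The length `c log₂ n` of the vectors, rounded down to an integer. -/
noncomputable def dim (c : ℝ) (n : ℕ) : ℕ := ⌊c * Real.logb 2 n⌋₊

/-- The initial state for the query `u`: the memory is the preprocessed data structure, register
`0` contains `u`, and all other registers are `0`. -/
def startState {d w s : ℕ} (mem : Fin s → BitVec w) (u : Vec d) : WordRAM.State w s where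
  reg := Function.update (fun _ => 0) 0 (encode w u)
  mem := mem

/-! ### The constant `c₁` -/

/-- `f = Õ(g)`, where all factors below every power `n ^ η`, `η > 0`, are suppressed. -/
def IsSoftO (f g : ℕ → ℝ) : Prop :=
  ∀ η : ℝ, 0 < η → f =O[atTop] fun n : ℕ => g n * (n : ℝ) ^ η

/-- The numbers `0 < x ≤ c / 2` with `binom(c log n, x log n) = Õ(n ^ (1 - δ))` for some
`δ > 0`. -/
def sparseThresholds (c : ℝ) : Set ℝ :=
  {x | 0 < x ∧ x ≤ c / 2 ∧ ∃ δ : ℝ, 0 < δ ∧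
    IsSoftO (fun n : ℕ => ((dim c n).choose ⌊x * Real.logb 2 n⌋₊ : ℝ))
      (fun n : ℕ => (n : ℝ) ^ (1 - δ))}

/-! ### The data structure DivideByOnes

The vectors with at most `t` ones are kept in one list. The first `m₁ * b` coordinates are divided
into `m₁` consecutive blocks of length `b`, and there is one array for every choice of `m₂` of
these blocks. -/

/-- The coordinates in the blocks with index in `J`. -/
def blockCoords (d b : ℕ) {m₁ : ℕ} (J : Finset (Fin m₁)) : Finset (Fin d) :=
  {i | ∃ j ∈ J, (j : ℕ) * b ≤ i ∧ (i : ℕ) < ((j : ℕ) + 1) * b}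

/-- The bit patterns on `W`, written as vectors that vanish outside `W`. -/
def patterns {d : ℕ} (W : Finset (Fin d)) : Set (Vec d) := {a | ∀ i ∉ W, a i = false}

/-- The vectors with at most `t` ones. -/
def fewOnes {d : ℕ} (t : ℕ) (S : Finset (Vec d)) : Finset (Vec d) := {v ∈ S | ones v ≤ t}

/-- The vectors with more than `t` ones. -/
def manyOnes {d : ℕ} (t : ℕ) (S : Finset (Vec d)) : Finset (Vec d) := {v ∈ S | t < ones v}

/-- `part` sends every vector in `R` to a choice of `m₂` blocks with the largest number of ones
(ties are broken arbitrarily). -/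
def IsDivision {d m₁ : ℕ} (b m₂ : ℕ) (R : Finset (Vec d)) (part : Vec d → Finset (Fin m₁)) :
    Prop :=
  ∀ v ∈ R, (part v).card = m₂ ∧ ∀ J : Finset (Fin m₁), J.card = m₂ →
    onesOn (blockCoords d b J) v ≤ onesOn (blockCoords d b (part v)) v

/-- The list that belongs to the entry `a` of the array of `J`. -/
def entryList {d m₁ : ℕ} (b : ℕ) (R : Finset (Vec d)) (part : Vec d → Finset (Fin m₁))
    (J : Finset (Fin m₁)) (a : Vec d) : Finset (Vec d) :=
  {v ∈ R | part v = J ∧ innerOn (blockCoords d b J) v a = 0}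

/-- The memory cell with address `p` exists and contains the word `x`. -/
def HoldsAt {w s : ℕ} (mem : Fin s → BitVec w) (p : ℕ) (x : BitVec w) : Prop :=
  ∃ h : p < s, mem ⟨p, h⟩ = x

/-- The cells from address `p` on contain the vectors in `F`, in some order. -/
def HoldsList {d w s : ℕ} (mem : Fin s → BitVec w) (p : ℕ) (F : Finset (Vec d)) : Prop :=
  ∃ l : List (Vec d), l.Nodup ∧ l.toFinset = F ∧
    ∀ (i : ℕ) (h : i < l.length), HoldsAt mem (p + i) (encode w l[i])

open scoped Classical in
/-- From address `p` on there is a table with `2 ^ (d - |W|)` entries that tells for every pattern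
`r` on the coordinates outside `W` whether some vector in `S` is orthogonal to the vector that is
`a` on `W` and `r` outside `W`. -/
def HoldsBitmap {d w s : ℕ} (mem : Fin s → BitVec w) (p : ℕ) (S : Finset (Vec d))
    (W : Finset (Fin d)) (a : Vec d) : Prop :=
  ∃ num : Vec d → ℕ, Set.BijOn num (patterns Wᶜ) (Set.Iio (2 ^ Wᶜ.card)) ∧
    ∀ r ∈ patterns Wᶜ, HoldsAt mem (p + num r)
      (if ∃ v ∈ S, Orthogonal v (fun i => a i || r i) then 1 else 0)

/-- The memory contains the DivideByOnes data structure for `S`: the list of all vectors with at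
most `t` ones and, for every choice `J` of `m₂` blocks, an array indexed by the bit patterns `a`
on `J`, whose entries point to the list that belongs to `a` if that list has at most `L` vectors,
and to a bitmap otherwise. -/
def HoldsDivideByOnes {d w s : ℕ} (t b m₁ m₂ L : ℕ) (S : Finset (Vec d))
    (mem : Fin s → BitVec w) : Prop :=
  (∃ p, HoldsList mem p (fewOnes t S)) ∧
  ∃ part : Vec d → Finset (Fin m₁), IsDivision b m₂ (manyOnes t S) part ∧
    ∀ J : Finset (Fin m₁), J.card = m₂ →
      ∃ (q : ℕ) (num : Vec d → ℕ),
        Set.BijOn num (patterns (blockCoords d b J)) (Set.Iio (2 ^ (blockCoords d b J).card)) ∧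
        ∀ a ∈ patterns (blockCoords d b J), ∃ p : BitVec w,
          HoldsAt mem (q + num a) p ∧
          if (entryList b (manyOnes t S) part J a).card ≤ L then
            HoldsList mem p.toNat (entryList b (manyOnes t S) part J a)
          else HoldsBitmap mem p.toNat S (blockCoords d b J) a

end OVIndexing

/-! ### Vectors as machine words -/

namespace OVIndexing

/-! Write ℓ = log₂ n, t = ⌊xℓ⌋, M = m₂b, and fix x in `sparseThresholds c` near c₁ and a small η >
0; γ is taken equal to η.

Space. A vector with more than t ones has, in the best m₂ of the m₁ blocks, at least the fraction
m₂/m₁ ≈ (c-1)/c of its ones in the blocks, because every chosen block is at least as full as every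
rejected one (`mul_onesOn_le`). This gives κℓ - O(1) ones with κ = (c-1-η)/c · (x-η)
(`le_ones_part`). A pattern orthogonal to the vector there must vanish at all these ones, so the
vector enters at most O(2^M n^(-κ)) lists, and all lists together have length O(n^(1-κ) 2^M)
(`sum_card_entryList_le`). Hence at most O(n^(η-κ) 2^M) lists are longer than L = ⌊n^(1-η)⌋. Each is
replaced by a bitmap with 2^(d-M) entries, so the bitmaps occupy O(n^(c-κ+η)) words, which dominates
everything else (`size_le`).

Time. The sparse vectors number at most (t+1)·binom(d,t), which is truly sublinear because x is
admissible. There are constantly many arrays, and each costs O(d) steps for addresses plus either a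
scan of at most L vectors or one bitmap lookup (`time_le`).

Correctness. A dense vector orthogonal to the query u lies in the list of its own part at the
pattern of u, while a bitmap entry answers the query for all of S (`exists_divideByOnes`).

As x → c₁ and η → 0, κ tends to c₁(c-1)/c, which exceeds the saving to be proved.
`exists_parameters` keeps a strict gap, and this gap pays for spending a whole word of O(log n) bits
on every cell, including single bitmap bits. `exists_arrays` and `runs_evalArrays` realise the
structure and the query on the word RAM. -/

theorem sum_toNat_mul_two_pow {d : ℕ} (v : Vec d) :
    ∑ i : Fin d, (v i).toNat * 2 ^ (i : ℕ) = Nat.ofBits v := by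
  induction d with
  | zero => simp [Nat.ofBits]
  | succ d ih =>
    rw [Fin.sum_univ_succ, Nat.ofBits_succ, ← ih (v ∘ Fin.succ), Finset.mul_sum, add_comm]
    simp only [Fin.val_zero, pow_zero, mul_one, Fin.val_succ, pow_succ, Function.comp]
    congr 1
    exact Finset.sum_congr rfl fun i _ => by ring

theorem getLsbD_encode {d w : ℕ} (v : Vec d) (i : ℕ) :
    (encode w v).getLsbD i = (decide (i < w) && if h : i < d then v ⟨i, h⟩ else false) := by
  rw [encode, BitVec.getLsbD_ofNat, sum_toNat_mul_two_pow, Nat.testBit_ofBits]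

theorem orthogonal_iff {d : ℕ} (u v : Vec d) :
    Orthogonal u v ↔ ∀ i, (u i && v i) = false := by
  simp only [Orthogonal, innerOn, Finset.sum_eq_zero_iff, Finset.mem_univ, forall_true_left]
  exact forall_congr' fun i => by cases u i <;> cases v i <;> simp

/-- A vector fits into one word, so a single bitwise AND decides orthogonality; this makes the list
scan cost O(1) per vector. -/
theorem encode_and_encode_eq_zero_iff {d w : ℕ} (hd : d ≤ w) (u v : Vec d) :
    encode w u &&& encode w v = 0 ↔ Orthogonal u v := by
  rw [orthogonal_iff]
  constructor
  · intro h i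
    have := congrArg (fun x => BitVec.getLsbD x i) h
    simp only [BitVec.getLsbD_and, getLsbD_encode] at this
    simpa [i.2.trans_le hd] using this
  · intro h
    refine BitVec.eq_of_getLsbD_eq fun i hi => ?_
    simp only [BitVec.getLsbD_and, getLsbD_encode]
    by_cases hid : i < d
    · simpa [hi, hid] using h ⟨i, hid⟩
    · simp [hid]

theorem encode_shiftRight_and_one {d w : ℕ} (hd : d ≤ w) (u : Vec d) (i : Fin d) :
    (encode w u >>> (i : ℕ)) &&& BitVec.ofNat w 1 = BitVec.ofNat w (u i).toNat := by
  refine BitVec.eq_of_getLsbD_eq fun j hj => ?_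
  rw [BitVec.getLsbD_and, BitVec.getLsbD_ushiftRight, getLsbD_encode, BitVec.getLsbD_ofNat,
    BitVec.getLsbD_ofNat]
  have hi := i.2.trans_le hd
  rcases Nat.eq_zero_or_pos j with rfl | hj0
  · cases h : u i <;> simp [hi, hj, h]
  · have h1 : Nat.testBit 1 j = false := by
      rw [Bool.eq_false_iff, ne_eq, Nat.testBit_one_eq_true_iff_self_eq_zero]; omega
    cases u i <;> simp [h1]

end OVIndexing

/-! ### Cost-bounded program logic and the query program -/

namespace WordRAM

open OVIndexing

variable {w s : ℕ}

/-- Started in `σ`, the program `P` halts within `T` steps in a state that satisfies `Q`. -/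
def Runs (P : Cmd) (σ : State w s) (T : ℕ) (Q : State w s → Prop) : Prop :=
  ∃ σ' T', Exec P σ σ' T' ∧ T' ≤ T ∧ Q σ'

theorem Runs.mono {P : Cmd} {σ : State w s} {T T' : ℕ} {Q Q' : State w s → Prop}
    (h : Runs P σ T Q) (hT : T ≤ T') (hQ : ∀ σ', Q σ' → Q' σ') : Runs P σ T' Q' := by
  obtain ⟨σ', t, he, ht, hq⟩ := h
  exact ⟨σ', t, he, ht.trans hT, hQ _ hq⟩

theorem Runs.assign {r : ℕ} {e : Expr} {σ : State w s} {Q : State w s → Prop}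
    (h : Q (σ.setReg r (e.eval σ))) : Runs (.assign r e) σ (e.cost + 1) Q :=
  ⟨_, _, Exec.assign r e σ, le_rfl, h⟩

theorem Runs.seq {P P' : Cmd} {σ : State w s} {T T' : ℕ} {Q : State w s → Prop}
    (h : Runs P σ T fun σ' => Runs P' σ' T' Q) : Runs (.seq P P') σ (T + T') Q := by
  obtain ⟨σ', t, he, ht, σ'', t', he', ht', hq⟩ := h
  exact ⟨σ'', t + t', he.seq he', by omega, hq⟩

theorem Runs.seq_of {P P' : Cmd} {σ : State w s} {T T' T'' : ℕ} {R Q : State w s → Prop}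
    (hT : T + T' ≤ T'') (h : Runs P σ T R) (h' : ∀ σ', R σ' → Runs P' σ' T' Q) :
    Runs (.seq P P') σ T'' Q :=
  (Runs.seq (h.mono le_rfl h')).mono hT fun _ h => h

theorem Runs.assign_seq {P : Cmd} {r : ℕ} {e : Expr} {v : BitVec w} {σ : State w s} {T T' : ℕ}
    {Q : State w s → Prop} (hv : e.eval σ = v) (hT : e.cost + 1 + T ≤ T')
    (h : Runs P (σ.setReg r v) T Q) : Runs (.seq (.assign r e) P) σ T' Q :=
  (Runs.seq (Runs.assign (by rwa [hv]))).mono hT fun _ h => h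

theorem State.reg_setReg (σ : State w s) (r r' : ℕ) (x : BitVec w) :
    (σ.setReg r x).reg r' = if r' = r then x else σ.reg r' := by
  simp [State.setReg, Function.update_apply]

theorem State.mem_setReg (σ : State w s) (r : ℕ) (x : BitVec w) : (σ.setReg r x).mem = σ.mem := rfl

theorem Runs.ite {e : Expr} {P P' : Cmd} {σ : State w s} {T : ℕ} {Q : State w s → Prop}
    (h : e.eval σ ≠ 0 → Runs P σ T Q) (h' : e.eval σ = 0 → Runs P' σ T Q) :
    Runs (.ite e P P') σ (e.cost + 1 + T) Q := by
  by_cases h0 : e.eval σ = 0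
  · obtain ⟨σ', t, he, ht, hq⟩ := h' h0
    exact ⟨σ', _, .iteFalse h0 he, by omega, hq⟩
  · obtain ⟨σ', t, he, ht, hq⟩ := h h0
    exact ⟨σ', _, .iteTrue h0 he, by omega, hq⟩

/-- The rule for counting loops: `I k` holds after `k` of the `N` rounds, and the `k`-th round
takes at most `T k` steps. -/
theorem Runs.loop {e : Expr} {P : Cmd} (N : ℕ) (T : ℕ → ℕ) (I : ℕ → State w s → Prop)
    (hstep : ∀ k < N, ∀ σ, I k σ → e.eval σ ≠ 0 ∧ Runs P σ (T k) (I (k + 1)))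
    (hend : ∀ σ, I N σ → e.eval σ = 0) {σ : State w s} (h0 : I 0 σ) :
    Runs (.while e P) σ (∑ k ∈ Finset.range N, (e.cost + 1 + T k) + (e.cost + 1)) (I N) := by
  induction N generalizing T I σ with
  | zero => exact ⟨σ, _, .whileFalse (hend σ h0), by simp, h0⟩
  | succ N ih =>
    obtain ⟨hne, σ', t, he, ht, hI⟩ := hstep 0 (by omega) σ h0
    obtain ⟨σ'', t', he', ht', hI'⟩ := ih (fun k => T (k + 1)) (fun k => I (k + 1))
      (fun k hk => hstep (k + 1) (by omega)) hend hI
    refine ⟨σ'', _, .whileTrue hne he he', ?_, hI'⟩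
    rw [Finset.sum_range_succ']
    omega

theorem Expr.eval_load {σ : State w s} {e : Expr} {p : ℕ} {x : BitVec w} (hs : s < 2 ^ w)
    (h : HoldsAt σ.mem p x) (he : e.eval σ = BitVec.ofNat w p) : (Expr.load e).eval σ = x := by
  obtain ⟨hp, hx⟩ := h
  have : (e.eval σ).toNat = p := by
    rw [he, BitVec.toNat_ofNat, Nat.mod_eq_of_lt (hp.trans hs)]
  simp only [Expr.eval, this, hp, dite_true, hx]

theorem Expr.eval_bin (σ : State w s) (o : Op) (e₁ e₂ : Expr) :
    (Expr.bin o e₁ e₂).eval σ = o.eval (e₁.eval σ) (e₂.eval σ) := rfl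

theorem or_ne_zero_iff {x y : BitVec w} : x ||| y ≠ 0 ↔ x ≠ 0 ∨ y ≠ 0 := by
  rw [ne_eq, show (0 : BitVec w) = 0#w from rfl, BitVec.or_eq_zero_iff]
  tauto

/-- Adds to register `5` the sum of the weights, stored from the address in register `4` on, of
the coordinates in which the vector in register `0` is one. The dimension is stored in cell `0`. -/
def addWeights : Cmd :=
  .seq (.assign 6 (.lit 0)) <|
  .while (.bin .lt (.reg 6) (.load (.lit 0))) <|
  .seq (.assign 5 (.bin .add (.reg 5)
    (.bin .mul (.bin .and (.bin .shr (.reg 0) (.reg 6)) (.lit 1))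
      (.load (.bin .add (.reg 4) (.reg 6))))))
  (.assign 6 (.bin .add (.reg 6) (.lit 1)))

/-- Puts a nonzero word into register `1` if one of the vectors in the list that starts at the
address in register `8` and has the length in register `9` is orthogonal to the vector in
register `0`. -/
def scanList : Cmd :=
  .seq (.assign 6 (.lit 0)) <|
  .while (.bin .lt (.reg 6) (.reg 9)) <|
  .seq (.assign 1 (.bin .or (.reg 1)
    (.bin .eq (.bin .and (.load (.bin .add (.reg 8) (.reg 6))) (.reg 0)) (.lit 0))))
  (.assign 6 (.bin .add (.reg 6) (.lit 1)))

/-- Machine comparison agrees with comparison of naturals only below 2^w, where reduction modulo 2^w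
is harmless. -/
theorem lt_eval_ofNat {a b : ℕ} (ha : a < 2 ^ w) (hb : b < 2 ^ w) :
    Op.eval .lt (BitVec.ofNat w a) (BitVec.ofNat w b) ≠ 0 ↔ a < b := by
  have hw : a < b → (1 : BitVec w) ≠ 0 := by
    intro hab h
    rcases Nat.eq_zero_or_pos w with rfl | hw
    -- In words of length zero 1 = 0, but then a and b both vanish and a < b fails.
    · simp at ha hb; omega
    · have := congrArg BitVec.toNat h
      simp [hw.ne'] at this
  simp only [Op.eval, BitVec.toNat_ofNat, Nat.mod_eq_of_lt ha, Nat.mod_eq_of_lt hb]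
  split_ifs with h
  · simpa [h] using hw h
  · simp [h]

theorem runs_addWeights {d : ℕ} {σ : State w s} (hs : s < 2 ^ w) (hd : d ≤ w) {u : Vec d}
    {wt : Fin d → ℕ} {q : ℕ} (h0 : HoldsAt σ.mem 0 (BitVec.ofNat w d)) (hu : σ.reg 0 = encode w u)
    (hq : σ.reg 4 = BitVec.ofNat w q)
    (hwt : ∀ i : Fin d, HoldsAt σ.mem (q + i) (BitVec.ofNat w (wt i))) :
    Runs addWeights σ (25 * (d + 1)) fun σ' => σ'.mem = σ.mem ∧
      σ'.reg 5 = σ.reg 5 + BitVec.ofNat w (∑ i, (u i).toNat * wt i) ∧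
      ∀ r, r ≠ 5 → r ≠ 6 → σ'.reg r = σ.reg r := by
  have hdw : d < 2 ^ w := hd.trans_lt Nat.lt_two_pow_self
  let I : ℕ → State w s → Prop := fun k σ' => σ'.mem = σ.mem ∧
      σ'.reg 5 = σ.reg 5 + BitVec.ofNat w
        (∑ i ∈ Finset.univ.filter fun i : Fin d => (i : ℕ) < k, (u i).toNat * wt i) ∧
      σ'.reg 6 = BitVec.ofNat w k ∧ ∀ r, r ≠ 5 → r ≠ 6 → σ'.reg r = σ.reg r
  refine Runs.mono (Runs.seq (T' := _) (Runs.assign (Runs.mono (Runs.loop d (fun _ => 17) I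
    ?_ ?_ ?_) le_rfl (fun _ h => h)))) ?_ (Q := I d) ?_
  · rintro k hk τ ⟨hm, h5, h6, hr⟩
    have hload : (Expr.load (.lit 0)).eval τ = BitVec.ofNat w d :=
      Expr.eval_load hs (hm ▸ h0) rfl
    have hload' : (Expr.load (.bin .add (.reg 4) (.reg 6))).eval τ = BitVec.ofNat w (wt ⟨k, hk⟩) :=
      Expr.eval_load hs (hm ▸ hwt ⟨k, hk⟩) (by
        simp only [Expr.eval, Op.eval, h6, hr 4 (by decide) (by decide), hq, BitVec.ofNat_add])
    refine ⟨?_, ?_⟩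
    · rw [Expr.eval, hload, Expr.eval, h6, lt_eval_ofNat (hk.trans hdw) hdw]
      exact hk
    · refine Runs.mono (Runs.seq (T' := _) (Runs.assign (Runs.assign (Q := I (k + 1)) ?_)))
        (by simp [Expr.cost]) (fun _ h => h)
      refine ⟨hm, ?_, ?_, ?_⟩
      · simp only [State.setReg, Function.update_self, Function.update_of_ne, ne_eq,
          Nat.reduceEqDiff, not_false_eq_true]
        rw [Expr.eval_bin, Expr.eval_bin, hload']
        simp only [Expr.eval, Op.eval, h6, hr 0 (by decide) (by decide), hu, h5]
        -- The shifted and masked word is the k-th bit of u, so this round adds the k-th weight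
        -- exactly when the bit is one.
        rw [BitVec.toNat_ofNat, Nat.mod_eq_of_lt (hk.trans hdw),
          encode_shiftRight_and_one hd u ⟨k, hk⟩, ← BitVec.ofNat_mul, BitVec.add_assoc,
          ← BitVec.ofNat_add]
        congr 2
        have : ({i : Fin d | (i : ℕ) < k + 1} : Finset (Fin d)) =
            insert ⟨k, hk⟩ ({i : Fin d | (i : ℕ) < k} : Finset (Fin d)) := by
          ext i; simp [Fin.ext_iff]; omega
        rw [this, Finset.sum_insert (by simp), add_comm]
      · simp [State.setReg, Expr.eval, Op.eval, h6, BitVec.ofNat_add]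
      · intro r h5' h6'
        simp [State.setReg, h5', h6', hr r h5' h6']
  · rintro τ ⟨hm, h5, h6, hr⟩
    have hload : (Expr.load (.lit 0)).eval τ = BitVec.ofNat w d :=
      Expr.eval_load hs (hm ▸ h0) rfl
    rw [Expr.eval, hload, Expr.eval, h6, ← not_not (a := _ = _), ← ne_eq, lt_eval_ofNat hdw hdw]
    exact lt_irrefl d
  · refine ⟨rfl, ?_, ?_, ?_⟩
    · simp [State.setReg]
    · simp [State.setReg, Expr.eval]
    · intro r h5 h6
      simp [State.setReg, h6]
  · simp [Expr.cost]; omega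
  · rintro τ ⟨hm, h5, h6, hr⟩
    refine ⟨hm, ?_, hr⟩
    rw [h5]; simp

theorem runs_scanList {d : ℕ} {σ : State w s} (hs : s < 2 ^ w) (hd : d ≤ w) {u : Vec d}
    {p : ℕ} {l : List (Vec d)} (hl : l.length < 2 ^ w) (hw : 0 < w)
    (hu : σ.reg 0 = encode w u) (hp : σ.reg 8 = BitVec.ofNat w p)
    (hlen : σ.reg 9 = BitVec.ofNat w l.length)
    (hmem : ∀ (i : ℕ) (h : i < l.length), HoldsAt σ.mem (p + i) (encode w l[i])) :
    Runs scanList σ (20 * (l.length + 1)) fun σ' => σ'.mem = σ.mem ∧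
      (σ'.reg 1 ≠ 0 ↔ σ.reg 1 ≠ 0 ∨ ∃ v ∈ l, Orthogonal v u) ∧
      ∀ r, r ≠ 1 → r ≠ 6 → σ'.reg r = σ.reg r := by
  have h10 : (1 : BitVec w) ≠ 0 := by
    intro h
    have := congrArg BitVec.toNat h
    simp [hw.ne'] at this
  let I : ℕ → State w s → Prop := fun k σ' => σ'.mem = σ.mem ∧
      (σ'.reg 1 ≠ 0 ↔ σ.reg 1 ≠ 0 ∨ ∃ v ∈ l.take k, Orthogonal v u) ∧
      σ'.reg 6 = BitVec.ofNat w k ∧ ∀ r, r ≠ 1 → r ≠ 6 → σ'.reg r = σ.reg r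
  refine Runs.mono (Runs.seq (T' := _) (Runs.assign (Runs.mono (Runs.loop l.length (fun _ => 15) I
    ?_ ?_ ?_) le_rfl (fun _ h => h)))) ?_ (Q := I l.length) ?_
  · rintro k hk τ ⟨hm, h1, h6, hr⟩
    have hload : (Expr.load (.bin .add (.reg 8) (.reg 6))).eval τ = encode w l[k] :=
      Expr.eval_load hs (hm ▸ hmem k hk) (by
        simp only [Expr.eval, Op.eval, h6, hr 8 (by decide) (by decide), hp, BitVec.ofNat_add])
    refine ⟨?_, ?_⟩
    · rw [Expr.eval, Expr.eval, Expr.eval, h6, hr 9 (by decide) (by decide), hlen,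
        lt_eval_ofNat (hk.trans hl) hl]
      exact hk
    · refine Runs.mono (Runs.seq (T' := _) (Runs.assign (Runs.assign (Q := I (k + 1)) ?_)))
        (by simp [Expr.cost]) (fun _ h => h)
      refine ⟨hm, ?_, ?_, ?_⟩
      · simp only [State.setReg, Function.update_self, Function.update_of_ne, ne_eq,
          OfNat.one_ne_ofNat, not_false_eq_true]
        rw [Expr.eval_bin, Expr.eval_bin, Expr.eval_bin, hload]
        simp only [Expr.eval, Op.eval, hr 0 (by decide) (by decide), hu]
        rw [show BitVec.ofNat w 0 = 0 from rfl, ← ne_eq]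
        rw [or_ne_zero_iff, h1, or_assoc, List.take_add_one, List.getElem?_eq_getElem hk]
        simp only [Option.toList_some, List.mem_append,
          List.mem_singleton, or_and_right, exists_or, exists_eq_left]
        refine or_congr_right (or_congr_right ?_)
        rw [← encode_and_encode_eq_zero_iff hd]
        split_ifs with ho <;> simp only [ho, h10, ne_eq, not_true, not_false_eq_true]
      · simp [State.setReg, Expr.eval, Op.eval, h6, BitVec.ofNat_add]
      · intro r h5' h6'
        simp [State.setReg, h5', h6', hr r h5' h6']
  · rintro τ ⟨hm, h1, h6, hr⟩
    rw [Expr.eval, Expr.eval, Expr.eval, h6, hr 9 (by decide) (by decide), hlen,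
      ← not_not (a := _ = _), ← ne_eq, lt_eval_ofNat hl hl]
    exact lt_irrefl _
  · refine ⟨rfl, ?_, ?_, ?_⟩
    · simp [State.setReg]
    · simp [State.setReg, Expr.eval]
    · intro r h5 h6
      simp [State.setReg, h6]
  · simp [Expr.cost]; omega
  · rintro τ ⟨hm, h1, h6, hr⟩
    refine ⟨hm, ?_, hr⟩
    rw [h1]; simp

/-- Evaluates the array whose descriptor starts at the address in register `3`: its three cells
contain the addresses of the array, of the weights of the coordinates in its index, and of the
weights of the coordinates in the index of a bitmap. The cell before a list contains one more than
the length of the list, and the cell before a bitmap contains zero. -/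
def evalArray : Cmd :=
  .seq (.assign 5 (.load (.reg 3))) <|
  .seq (.assign 4 (.load (.bin .add (.reg 3) (.lit 1)))) <|
  .seq addWeights <|
  .seq (.assign 8 (.load (.reg 5))) <|
  .seq (.assign 9 (.load (.bin .sub (.reg 8) (.lit 1)))) <|
  .seq (.ite (.reg 9)
    (.seq (.assign 9 (.bin .sub (.reg 9) (.lit 1))) scanList)
    (.seq (.assign 5 (.reg 8)) <|
     .seq (.assign 4 (.load (.bin .add (.reg 3) (.lit 2)))) <|
     .seq addWeights (.assign 1 (.bin .or (.reg 1) (.load (.reg 5)))))) <|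
  .seq (.assign 3 (.bin .add (.reg 3) (.lit 3)))
    (.assign 2 (.bin .add (.reg 2) (.lit 1)))

/-- Evaluates all arrays. Their number is stored in cell `1`, and their descriptors are stored from
cell `2` on. -/
def evalArrays : Cmd :=
  .seq (.assign 3 (.lit 2)) <|
  .seq (.while (.bin .lt (.reg 2) (.load (.lit 1))) evalArray)
    (.assign 0 (.reg 1))

/-- The array whose descriptor starts in cell `g` answers the query `u` by `X`, after the
inspection of at most `M` vectors. -/
def Answers {d : ℕ} (mem : Fin s → BitVec w) (u : Vec d) (g M : ℕ) (X : Prop) : Prop :=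
  ∃ (q a a' p : ℕ) (wt wt' : Fin d → ℕ), HoldsAt mem g (BitVec.ofNat w q) ∧
    HoldsAt mem (g + 1) (BitVec.ofNat w a) ∧ HoldsAt mem (g + 2) (BitVec.ofNat w a') ∧
    (∀ i : Fin d, HoldsAt mem (a + i) (BitVec.ofNat w (wt i))) ∧
    (∀ i : Fin d, HoldsAt mem (a' + i) (BitVec.ofNat w (wt' i))) ∧
    HoldsAt mem (q + ∑ i, (u i).toNat * wt i) (BitVec.ofNat w (p + 1)) ∧
    ((∃ l : List (Vec d), l.length ≤ M ∧ HoldsAt mem p (BitVec.ofNat w (l.length + 1)) ∧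
        (∀ (i : ℕ) (h : i < l.length), HoldsAt mem (p + 1 + i) (encode w l[i])) ∧
        (X ↔ ∃ v ∈ l, Orthogonal v u)) ∨
      (HoldsAt mem p 0 ∧ ∃ x, HoldsAt mem (p + 1 + ∑ i, (u i).toNat * wt' i) x ∧ (X ↔ x ≠ 0)))

/-- One pass computes the index of the entry from the weights, follows the pointer, and branches on
the marker cell just before the target: nonzero means a list, zero a bitmap. Each of the at most two
address computations costs O(d). -/
theorem runs_evalArray {d M g : ℕ} {σ : State w s} (hs : s < 2 ^ w) (hd : d ≤ w) (hw : 0 < w)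
    {u : Vec d} {X : Prop} (h0 : HoldsAt σ.mem 0 (BitVec.ofNat w d))
    (hu : σ.reg 0 = encode w u) (hg : σ.reg 3 = BitVec.ofNat w g) (hX : Answers σ.mem u g M X) :
    Runs evalArray σ (120 * (d + 1) + 20 * M) fun σ' => σ'.mem = σ.mem ∧
      (σ'.reg 1 ≠ 0 ↔ σ.reg 1 ≠ 0 ∨ X) ∧ σ'.reg 0 = σ.reg 0 ∧
      σ'.reg 2 = σ.reg 2 + BitVec.ofNat w 1 ∧ σ'.reg 3 = BitVec.ofNat w (g + 3) := by
  obtain ⟨q, a, a', p, wt, wt', hq, ha, ha', hwt, hwt', hp, hX⟩ := hX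
  have h1w : 1 < 2 ^ w := Nat.one_lt_two_pow hw.ne'
  have hsub : ∀ k : ℕ, BitVec.ofNat w (k + 1) - BitVec.ofNat w 1 = BitVec.ofNat w k := fun k => by
    rw [BitVec.ofNat_add, BitVec.add_sub_cancel]
  refine Runs.assign_seq (T := 115 * (d + 1) + 20 * M) (Expr.eval_load hs hq hg)
    (by simp [Expr.cost]; omega) ?_
  refine Runs.assign_seq (T := 110 * (d + 1) + 20 * M) (Expr.eval_load hs ha ?_)
    (by simp [Expr.cost]; omega) ?_
  · simp [Expr.eval, Op.eval, State.reg_setReg, hg, BitVec.ofNat_add]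
  refine Runs.seq_of (T' := 85 * (d + 1) + 20 * M) (by omega)
    (runs_addWeights (q := a) (u := u) (wt := wt) hs hd h0 ?_ ?_ hwt) ?_
  · simp [State.reg_setReg, hu]
  · simp [State.reg_setReg]
  rintro σ₁ ⟨hm, h5, hr⟩
  replace hm : σ₁.mem = σ.mem := hm
  have e5 : σ₁.reg 5 = BitVec.ofNat w (q + ∑ i, (u i).toNat * wt i) := by
    rw [h5, BitVec.ofNat_add]
    simp [State.reg_setReg]
  have e0 : σ₁.reg 0 = σ.reg 0 := by simp [hr, State.reg_setReg]
  have e1 : σ₁.reg 1 = σ.reg 1 := by simp [hr, State.reg_setReg]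
  have e2 : σ₁.reg 2 = σ.reg 2 := by simp [hr, State.reg_setReg]
  have e3 : σ₁.reg 3 = BitVec.ofNat w g := by simp [hr, State.reg_setReg, hg]
  clear hr h5
  obtain ⟨x, hx⟩ : ∃ x, HoldsAt σ.mem p x := by
    rcases hX with ⟨l, -, h, -⟩ | ⟨h, -⟩ <;> exact ⟨_, h⟩
  refine Runs.assign_seq (T := 80 * (d + 1) + 20 * M) (Expr.eval_load hs (hm ▸ hp) e5)
    (by simp [Expr.cost]; omega) ?_
  refine Runs.assign_seq (T := 75 * (d + 1) + 20 * M) (Expr.eval_load (p := p) hs (hm ▸ hx) ?_)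
    (by simp [Expr.cost]; omega) ?_
  · rw [Expr.eval_bin]
    exact hsub p
  refine Runs.seq_of (T := 65 * (d + 1) + 20 * M) (T' := 10) (R := fun σ' => σ'.mem = σ.mem ∧
        (σ'.reg 1 ≠ 0 ↔ σ.reg 1 ≠ 0 ∨ X) ∧ σ'.reg 0 = σ.reg 0 ∧
        σ'.reg 2 = σ.reg 2 ∧ σ'.reg 3 = BitVec.ofNat w g) (by omega) ?_ ?_
  · refine Runs.mono (Runs.ite (T := 60 * (d + 1) + 20 * M) ?_ ?_)
      (by simp [Expr.cost]; omega) (fun _ h => h)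
    · intro hne
      replace hne : x ≠ 0 := by simpa [Expr.eval, State.reg_setReg] using hne
      obtain ⟨l, hl, hpl, hll, hX⟩ | ⟨h, -⟩ := hX
      -- The last vector of a nonempty list has address p + length < s, so the stored marker length
      -- + 1 does not wrap around.
      · have hlen : l.length + 1 < 2 ^ w := by
          rcases Nat.eq_zero_or_pos l.length with h | h
          · rwa [h]
          · obtain ⟨hlt, -⟩ := hll (l.length - 1) (by omega)
            omega
        obtain rfl : x = _ := hx.2.symm.trans hpl.2
        refine Runs.assign_seq (T := 20 * (l.length + 1)) (hsub l.length)
          (by simp [Expr.cost]; omega) ?_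
        refine Runs.mono (runs_scanList hs hd (u := u) (p := p + 1) (l := l) (by omega) hw ?_ ?_ ?_
          ?_) le_rfl ?_
        · simp [State.reg_setReg, e0, hu]
        · simp [State.reg_setReg]
        · simp [State.reg_setReg]
        · simpa [State.mem_setReg, hm] using hll
        · rintro τ ⟨hτ, h1, hr⟩
          refine ⟨by simp [hτ, State.mem_setReg, hm], ?_, ?_, ?_, ?_⟩
          · rw [h1, hX]; simp [State.reg_setReg, e1]
          all_goals simp [hr, State.reg_setReg, e0, e2, e3]
      · exact absurd (hx.2.symm.trans h.2) hne
    · intro he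
      replace he : x = 0 := by simpa [Expr.eval, State.reg_setReg] using he
      obtain ⟨l, hl, hpl, hll, hX⟩ | ⟨-, y, hy, hX⟩ := hX
      -- A list has marker length + 1, which is nonzero even after reduction modulo 2^w; a zero
      -- marker therefore excludes a list.
      · exfalso
        have hlen : l.length + 1 < 2 ^ w := by
          rcases Nat.eq_zero_or_pos l.length with h | h
          · rwa [h]
          · obtain ⟨hlt, -⟩ := hll (l.length - 1) (by omega)
            omega
        have := congrArg BitVec.toNat (hpl.2.symm.trans (hx.2.trans he))
        rw [BitVec.toNat_ofNat, Nat.mod_eq_of_lt hlen] at this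
        simp at this
      · refine Runs.assign_seq (v := BitVec.ofNat w (p + 1)) (T := 50 * (d + 1) + 20 * M) ?_
          (by simp [Expr.cost]; omega) ?_
        · simp [Expr.eval, State.reg_setReg]
        refine Runs.assign_seq (v := BitVec.ofNat w a') (T := 40 * (d + 1) + 20 * M)
          (Expr.eval_load (p := g + 2) hs ?_ ?_) (by simp [Expr.cost]; omega) ?_
        · simpa [State.mem_setReg, hm] using ha'
        · simp [Expr.eval, Op.eval, State.reg_setReg, e3, BitVec.ofNat_add]
        refine Runs.seq_of (T' := 15) (by omega)
          (runs_addWeights (q := a') (u := u) (wt := wt') hs hd ?_ ?_ ?_ ?_) ?_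
        · simpa [State.mem_setReg, hm] using h0
        · simp [State.reg_setReg, e0, hu]
        · simp [State.reg_setReg]
        · simpa [State.mem_setReg, hm] using hwt'
        rintro τ ⟨hτ, h5, hr⟩
        replace hτ : τ.mem = σ.mem := by rw [hτ]; exact hm
        refine Runs.mono (Runs.assign ?_) (by simp [Expr.cost]) (fun _ h => h)
        have hload : (Expr.load (.reg 5)).eval τ = y := by
          refine Expr.eval_load hs (hτ ▸ hy) ?_
          rw [Expr.eval, h5]
          simp [State.reg_setReg, BitVec.ofNat_add]
        rw [Expr.eval_bin, hload]
        refine ⟨by simp [hτ, State.mem_setReg], ?_, ?_, ?_, ?_⟩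
        · rw [hX, State.reg_setReg, if_pos rfl]
          simp only [Op.eval]
          rw [or_ne_zero_iff]
          simp [Expr.eval, hr, State.reg_setReg, e1]
        all_goals simp [hr, State.reg_setReg, e0, e2, e3]
  · rintro τ ⟨hm, h1, h0, h2, h3⟩
    refine Runs.assign_seq (v := BitVec.ofNat w (g + 3)) (T := 4) ?_ (by simp [Expr.cost]) ?_
    · simp [Expr.eval, Op.eval, h3, BitVec.ofNat_add]
    · refine Runs.mono (Runs.assign ?_) (by simp [Expr.cost]) (fun _ h => h)
      refine ⟨hm, h1, h0, ?_, ?_⟩ <;> simp [State.reg_setReg, h2, Expr.eval, Op.eval]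

/-- If the `k`-th array answers the query by `X k`, then the machine answers it by the disjunction
of all `X k`. -/
theorem runs_evalArrays {d N : ℕ} {mem : Fin s → BitVec w} (hs : s < 2 ^ w) (hd : d ≤ w)
    (hw : 0 < w) (hN : N < 2 ^ w) {u : Vec d} {M : ℕ → ℕ} {X : ℕ → Prop}
    (h0 : HoldsAt mem 0 (BitVec.ofNat w d)) (h1 : HoldsAt mem 1 (BitVec.ofNat w N))
    (hX : ∀ k < N, Answers mem u (2 + 3 * k) (M k) (X k)) :
    Runs evalArrays (startState mem u) (∑ k ∈ Finset.range N, (130 * (d + 1) + 20 * M k) + 20)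
      fun σ' => σ'.reg 0 ≠ 0 ↔ ∃ k < N, X k := by
  let I : ℕ → State w s → Prop := fun k σ' => σ'.mem = mem ∧
    (σ'.reg 1 ≠ 0 ↔ ∃ j < k, X j) ∧ σ'.reg 0 = encode w u ∧ σ'.reg 2 = BitVec.ofNat w k ∧
    σ'.reg 3 = BitVec.ofNat w (2 + 3 * k)
  refine Runs.assign_seq (v := BitVec.ofNat w 2) (T :=
    ∑ k ∈ Finset.range N, (5 + (120 * (d + 1) + 20 * M k)) + 5 + 2) rfl ?_ ?_
  · have : ∑ k ∈ Finset.range N, (5 + (120 * (d + 1) + 20 * M k)) ≤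
        ∑ k ∈ Finset.range N, (130 * (d + 1) + 20 * M k) :=
      Finset.sum_le_sum fun _ _ => by omega
    simp only [Expr.cost]
    omega
  refine Runs.seq_of (R := I N) le_rfl (Runs.loop N _ I ?_ ?_ ?_) ?_
  · rintro k hk τ ⟨hm, h1', h0', h2, h3⟩
    have hload : (Expr.load (.lit 1)).eval τ = BitVec.ofNat w N :=
      Expr.eval_load hs (hm ▸ h1) rfl
    refine ⟨?_, ?_⟩
    · rw [Expr.eval_bin, hload, Expr.eval, h2, lt_eval_ofNat (hk.trans hN) hN]
      exact hk
    · refine Runs.mono (runs_evalArray (u := u) hs hd hw (hm ▸ h0) h0' h3 (hm ▸ hX k hk)) le_rfl ?_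
      rintro σ' ⟨hm', h1'', h0'', h2', h3'⟩
      refine ⟨hm'.trans hm, ?_, h0''.trans h0', ?_, ?_⟩
      · rw [h1'', h1']
        simp only [Nat.lt_succ_iff_lt_or_eq, or_and_right, exists_or, exists_eq_left]
      · rw [h2', h2, BitVec.ofNat_add]
      · rw [h3']; congr 1
  · rintro τ ⟨hm, h1', h0', h2, h3⟩
    have hload : (Expr.load (.lit 1)).eval τ = BitVec.ofNat w N :=
      Expr.eval_load hs (hm ▸ h1) rfl
    rw [Expr.eval_bin, hload, Expr.eval, h2, ← not_not (a := _ = _), ← ne_eq, lt_eval_ofNat hN hN]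
    exact lt_irrefl N
  · refine ⟨rfl, ?_, ?_, ?_, ?_⟩ <;> simp [State.reg_setReg, startState]
  · rintro τ ⟨hm, h1', h0', h2, h3⟩
    refine Runs.mono (Runs.assign ?_) (by simp [Expr.cost]) (fun _ h => h)
    simpa [State.reg_setReg, Expr.eval] using h1'

end WordRAM

/-! ### Memory layout of arrays, lists and bitmaps -/

namespace OVIndexing

open WordRAM

/-- The vector that agrees with `u` on `W` and vanishes outside `W`. -/
def mask {d : ℕ} (W : Finset (Fin d)) (u : Vec d) : Vec d := fun i => decide (i ∈ W) && u i

theorem mask_mem_patterns {d : ℕ} (W : Finset (Fin d)) (u : Vec d) : mask W u ∈ patterns W :=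
  fun i hi => by simp [mask, hi]

theorem mask_or_mask_compl {d : ℕ} (W : Finset (Fin d)) (u : Vec d) :
    (fun i => mask W u i || mask Wᶜ u i) = u := by
  funext i
  by_cases hi : i ∈ W <;> simp [mask, hi]

/-- Since the weights vanish outside W, the program can index with the whole query and never has to
extract its pattern on W. -/
theorem sum_mask_mul {d : ℕ} {W : Finset (Fin d)} {wt : Fin d → ℕ} (hwt : ∀ i ∉ W, wt i = 0)
    (u : Vec d) : ∑ i, (mask W u i).toNat * wt i = ∑ i, (u i).toNat * wt i := by
  refine Finset.sum_congr rfl fun i _ => ?_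
  by_cases hi : i ∈ W
  · simp [mask, hi]
  · simp [hwt i hi]

/-- The patterns on `W` can be numbered by sums of weights of the coordinates in `W`. -/
theorem exists_weights {d : ℕ} (W : Finset (Fin d)) : ∃ wt : Fin d → ℕ, (∀ i ∉ W, wt i = 0) ∧
    Set.BijOn (fun a : Vec d => ∑ i, (a i).toNat * wt i) (patterns W) (Set.Iio (2 ^ W.card)) := by
  -- Enumerating W and giving its coordinates the successive powers of two makes the weighted sum a
  -- binary expansion.
  let e := W.equivFin
  let wt : Fin d → ℕ := fun i => if h : i ∈ W then 2 ^ (e ⟨i, h⟩ : ℕ) else 0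
  have hsum : ∀ a : Vec d, ∑ i, (a i).toNat * wt i = Nat.ofBits fun k => a (e.symm k) := by
    intro a
    rw [← sum_toNat_mul_two_pow, ← Equiv.sum_comp e, ← Finset.sum_subset (Finset.subset_univ W),
      ← Finset.sum_coe_sort W]
    · refine Finset.sum_congr rfl fun i _ => ?_
      simp [wt]
    · intro i _ hi
      simp [wt, hi]
  refine ⟨wt, fun i hi => by simp [wt, hi], ?_, ?_, ?_⟩
  · intro a _
    simp only [hsum]
    exact Nat.ofBits_lt_two_pow _
  · intro a ha a' ha' h
    simp only [hsum] at h
    funext i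
    by_cases hi : i ∈ W
    · have := congrArg (fun x => Nat.testBit x (e ⟨i, hi⟩)) h
      simpa [Nat.testBit_ofBits_lt] using this
    · rw [ha i hi, ha' i hi]
  · intro m hm
    refine ⟨fun i => if h : i ∈ W then m.testBit (e ⟨i, h⟩) else false, fun i hi => by simp [hi], ?_⟩
    simp only [hsum]
    have : (fun k : Fin W.card => if h : (e.symm k : Fin d) ∈ W then
        m.testBit (e ⟨e.symm k, h⟩) else false) = fun k : Fin W.card => m.testBit k := by
      funext k
      simp
    rw [this, Nat.ofBits_testBit, Nat.mod_eq_of_lt hm]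

/-- Memory segments of given lengths can be laid out one after the other, behind a header of length
`h`. The addresses depend only on the lengths. -/
theorem exists_layout {ι : Type*} [Fintype ι] (h : ℕ) (len : ι → ℕ) :
    ∃ addr : ι → ℕ, (∀ i, addr i + len i ≤ h + ∑ i, len i) ∧
      ∀ (w : ℕ) (f₀ : ℕ → BitVec w) (f : ι → ℕ → BitVec w),
        ∃ mem : Fin (h + ∑ i, len i) → BitVec w, (∀ k < h, HoldsAt mem k (f₀ k)) ∧
          ∀ i, ∀ k < len i, HoldsAt mem (addr i + k) (f i k) := by
  classical
  -- The last clause says that segments are disjoint; it is phrased by cells so that empty segments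
  -- need no special treatment.
  have key : ∀ A : Finset ι, ∃ addr : ι → ℕ,
      (∀ i ∈ A, h ≤ addr i ∧ addr i + len i ≤ h + ∑ i ∈ A, len i) ∧
      ∀ i ∈ A, ∀ j ∈ A, ∀ k < len i, ∀ l < len j, addr i + k = addr j + l → i = j := by
    intro A
    induction A using Finset.induction_on with
    | empty => exact ⟨fun _ => 0, by simp⟩
    | insert a A ha ih =>
      obtain ⟨addr, h1, h2⟩ := ih
      have hne : ∀ i ∈ A, i ≠ a := fun i hi hia => ha (hia ▸ hi)
      refine ⟨Function.update addr a (h + ∑ i ∈ A, len i), ?_, ?_⟩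
      · intro i hi
        rw [Finset.sum_insert ha]
        rcases Finset.mem_insert.1 hi with rfl | hi
        · simp only [Function.update_self]; omega
        · rw [Function.update_of_ne (hne i hi)]
          have := h1 i hi
          omega
      · intro i hi j hj k hk l hl
        rcases Finset.mem_insert.1 hi with hia | hi <;>
          rcases Finset.mem_insert.1 hj with hja | hj
        · intro _; rw [hia, hja]
        · rw [hia, Function.update_self, Function.update_of_ne (hne j hj)]
          have := h1 j hj
          omega
        · rw [hja, Function.update_self, Function.update_of_ne (hne i hi)]
          have := h1 i hi
          omega
        · rw [Function.update_of_ne (hne i hi), Function.update_of_ne (hne j hj)]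
          exact h2 i hi j hj k hk l hl
  obtain ⟨addr, h1, h2⟩ := key Finset.univ
  refine ⟨addr, fun i => (h1 i (Finset.mem_univ i)).2, fun w f₀ f => ?_⟩
  -- A cell behind the header gets the content prescribed by a segment that covers it. By
  -- disjointness there is at most one, so the choice is forced.
  refine ⟨fun p => if (p : ℕ) < h then f₀ p else
    if H : ∃ x : ι × ℕ, x.2 < len x.1 ∧ (p : ℕ) = addr x.1 + x.2 then f H.choose.1 H.choose.2
    else 0, ?_, ?_⟩
  · intro k hk
    exact ⟨by omega, by simp [hk]⟩
  · intro i k hk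
    have hi := h1 i (Finset.mem_univ i)
    refine ⟨by omega, ?_⟩
    have H : ∃ x : ι × ℕ, x.2 < len x.1 ∧ addr i + k = addr x.1 + x.2 := ⟨(i, k), hk, rfl⟩
    have hs := H.choose_spec
    have hii : i = H.choose.1 :=
      h2 i (Finset.mem_univ _) _ (Finset.mem_univ _) k hk _ hs.1 hs.2
    have hkk : k = H.choose.2 := by
      have := hs.2
      rw [← hii] at this
      omega
    simp only [show ¬ addr i + k < h by omega, if_false]
    rw [dif_pos H, ← hii, ← hkk]

open scoped Classical in
/-- A memory with one array for every `k`, indexed by the patterns on `W k`, whose entry `a` points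
to a bitmap for `S` if `B k a` holds, and to the list `G k a` otherwise; and the running time of
the evaluation of these arrays. -/
theorem exists_arrays {d : ℕ} {κ : Type*} [Fintype κ] (S : Finset (Vec d))
    (W : κ → Finset (Fin d)) (G : κ → Vec d → Finset (Vec d)) (B : κ → Vec d → Prop) :
    ∃ s ≤ 2 + 3 * Fintype.card κ + ∑ k, (2 * d + 2 ^ (W k).card +
        ∑ a with a ∈ patterns (W k), (1 + if B k a then 2 ^ (W k)ᶜ.card else (G k a).card)),
      ∀ w, s < 2 ^ w → d ≤ w → 0 < w → ∃ mem : Fin s → BitVec w,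
        (∀ k, ∃ (q : ℕ) (num : Vec d → ℕ),
          Set.BijOn num (patterns (W k)) (Set.Iio (2 ^ (W k).card)) ∧
          ∀ a ∈ patterns (W k), ∃ p : BitVec w, HoldsAt mem (q + num a) p ∧
            if B k a then HoldsBitmap mem p.toNat S (W k) a else HoldsList mem p.toNat (G k a)) ∧
        ∀ (u : Vec d) (M : κ → ℕ),
          (∀ k, ¬ B k (mask (W k) u) → (G k (mask (W k) u)).card ≤ M k) →
          Runs evalArrays (startState mem u) (∑ k, (130 * (d + 1) + 20 * M k) + 20) fun σ =>
            σ.reg 0 ≠ 0 ↔ ∃ k, if B k (mask (W k) u) then ∃ v ∈ S, Orthogonal v u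
              else ∃ v ∈ G k (mask (W k) u), Orthogonal v u := by
  choose wt hwt hbij using fun k => exists_weights (W k)
  choose wt' hwt' hbij' using fun k => exists_weights (W k)ᶜ
  set N := Fintype.card κ with hN
  let e : κ ≃ Fin N := Fintype.equivFin κ
  -- Each k owns three tables (pointers, weights for W, weights for its complement) and, for every
  -- pattern, one marker cell followed by a list or bitmap. Vectors that are not patterns get empty
  -- segments.
  let len : κ × (Fin 3 ⊕ Vec d) → ℕ := fun x => match x.2 with
    | .inl c => if c = 0 then 2 ^ (W x.1).card else d
    | .inr a => if a ∈ patterns (W x.1) then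
        (1 + if B x.1 a then 2 ^ (W x.1)ᶜ.card else (G x.1 a).card) else 0
  obtain ⟨addr, haddr, hmem⟩ := exists_layout (2 + 3 * N) len
  refine ⟨2 + 3 * N + ∑ i, len i, ?_, ?_⟩
  · rw [add_le_add_iff_left, Fintype.sum_prod_type]
    refine Finset.sum_le_sum fun k _ => ?_
    rw [Fintype.sum_sum_type, Fin.sum_univ_three, Finset.sum_filter]
    simp only [len, if_true, Fin.reduceEq, if_false]
    omega
  intro w hs hd hw
  let num : κ → Vec d → ℕ := fun k a => ∑ i, (a i).toNat * wt k i
  let num' : κ → Vec d → ℕ := fun k a => ∑ i, (a i).toNat * wt' k i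
  let f₀ : ℕ → BitVec w := fun p => if p = 0 then BitVec.ofNat w d else
    if p = 1 then BitVec.ofNat w N else
    if h : (p - 2) / 3 < N then
      BitVec.ofNat w (addr (e.symm ⟨(p - 2) / 3, h⟩, .inl ⟨(p - 2) % 3, Nat.mod_lt _ (by omega)⟩))
    else 0
  -- Table positions are decoded back to patterns by inverting the numbering. Pointers aim one cell
  -- past the segment start, leaving the marker at the preceding cell.
  let f : κ × (Fin 3 ⊕ Vec d) → ℕ → BitVec w := fun x j => match x.2 with
    | .inl c => if c = 0 then
        BitVec.ofNat w (addr (x.1, .inr (Function.invFunOn (num x.1) (patterns (W x.1)) j)) + 1) else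
      if h : j < d then BitVec.ofNat w (if c = 1 then wt x.1 ⟨j, h⟩ else wt' x.1 ⟨j, h⟩) else 0
    | .inr a => if B x.1 a then
        (if j = 0 then 0 else if ∃ v ∈ S, Orthogonal v (fun i => a i ||
          Function.invFunOn (num' x.1) (patterns (W x.1)ᶜ) (j - 1) i) then 1 else 0)
      else if j = 0 then BitVec.ofNat w ((G x.1 a).card + 1) else
        if h : j - 1 < (G x.1 a).toList.length then encode w (G x.1 a).toList[j - 1] else 0
  obtain ⟨mem, hm₀, hm⟩ := hmem w f₀ f
  have hd0 : HoldsAt mem 0 (BitVec.ofNat w d) := hm₀ 0 (by omega)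
  have hN1 : HoldsAt mem 1 (BitVec.ofNat w N) := hm₀ 1 (by omega)
  have hdesc : ∀ (j : Fin N) (c : Fin 3),
      HoldsAt mem (2 + 3 * j + c) (BitVec.ofNat w (addr (e.symm j, .inl c))) := by
    intro j c
    have h1 : (2 + 3 * (j : ℕ) + c - 2) / 3 = j := by omega
    have h2 : (2 + 3 * (j : ℕ) + c - 2) % 3 = c := by omega
    have := hm₀ (2 + 3 * j + c) (by omega)
    simpa [f₀, h1, h2, show 2 + 3 * (j : ℕ) + c ≠ 0 by omega,
      show 2 + 3 * (j : ℕ) + c ≠ 1 by omega] using this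
  have harr : ∀ k, ∀ a ∈ patterns (W k), HoldsAt mem (addr (k, .inl 0) + num k a)
      (BitVec.ofNat w (addr (k, .inr a) + 1)) := by
    intro k a ha
    have := hm (k, .inl 0) (num k a) (by simpa [len] using (hbij k).mapsTo ha)
    simpa [f, (hbij k).injOn.leftInvOn_invFunOn ha, num] using this
  have hwt1 : ∀ k (i : Fin d), HoldsAt mem (addr (k, .inl 1) + i) (BitVec.ofNat w (wt k i)) := by
    intro k i
    simpa [f] using hm (k, .inl 1) i (by simp [len])
  have hwt2 : ∀ k (i : Fin d), HoldsAt mem (addr (k, .inl 2) + i) (BitVec.ofNat w (wt' k i)) := by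
    intro k i
    simpa [f] using hm (k, .inl 2) i (by simp [len])
  have hinfo : ∀ k, ∀ a ∈ patterns (W k), HoldsAt mem (addr (k, .inr a))
      (if B k a then 0 else BitVec.ofNat w ((G k a).card + 1)) := by
    intro k a ha
    simpa [f] using hm (k, .inr a) 0 (by simp [len, ha])
  have hlist : ∀ k, ∀ a ∈ patterns (W k), ¬ B k a → ∀ (i : ℕ) (h : i < (G k a).toList.length),
      HoldsAt mem (addr (k, .inr a) + 1 + i) (encode w (G k a).toList[i]) := by
    intro k a ha hB i hi
    have := hm (k, .inr a) (1 + i) (by simpa [len, ha, hB] using hi)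
    rw [← add_assoc] at this
    simpa only [f, hB, if_false, show 1 + i ≠ 0 by omega, add_tsub_cancel_left, hi, dite_true]
      using this
  have hbm : ∀ k, ∀ a ∈ patterns (W k), B k a → ∀ r ∈ patterns (W k)ᶜ,
      HoldsAt mem (addr (k, .inr a) + 1 + num' k r)
        (if ∃ v ∈ S, Orthogonal v (fun i => a i || r i) then 1 else 0) := by
    intro k a ha hB r hr
    have := hm (k, .inr a) (1 + num' k r) (by simpa [len, ha, hB] using (hbij' k).mapsTo hr)
    rw [← add_assoc] at this
    simpa only [f, hB, if_true, show 1 + num' k r ≠ 0 by omega, if_false, add_tsub_cancel_left,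
      (hbij' k).injOn.leftInvOn_invFunOn hr, num'] using this
  refine ⟨mem, fun k => ⟨addr (k, .inl 0), num k, hbij k, fun a ha => ⟨_, harr k a ha, ?_⟩⟩, ?_⟩
  -- The marker cell makes the segment nonempty, so the pointer is at most s and survives reduction
  -- modulo 2^w.
  · have hlt : addr (k, .inr a) + 1 < 2 ^ w := by
      have := haddr (k, .inr a)
      have h1 : 1 ≤ len (k, .inr a) := by simp [len, ha]
      omega
    rw [BitVec.toNat_ofNat, Nat.mod_eq_of_lt hlt]
    split_ifs with hB
    · exact ⟨num' k, hbij' k, hbm k a ha hB⟩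
    · exact ⟨_, Finset.nodup_toList _, Finset.toList_toFinset _, hlist k a ha hB⟩
  · intro u M hM
    have hX : ∀ k : κ, Answers mem u (2 + 3 * (e k)) (M k)
        (if B k (mask (W k) u) then ∃ v ∈ S, Orthogonal v u
          else ∃ v ∈ G k (mask (W k) u), Orthogonal v u) := by
      intro k
      have hk := mask_mem_patterns (W k) u
      refine ⟨addr (k, .inl 0), addr (k, .inl 1), addr (k, .inl 2), addr (k, .inr (mask (W k) u)),
        wt k, wt' k, ?_, ?_, ?_, hwt1 k, hwt2 k, ?_, ?_⟩
      · simpa using hdesc (e k) 0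
      · simpa using hdesc (e k) 1
      · simpa using hdesc (e k) 2
      · rw [← sum_mask_mul (hwt k)]
        exact harr k _ hk
      · have hi := hinfo k _ hk
        by_cases hB : B k (mask (W k) u)
        · right
          rw [if_pos hB] at hi
          refine ⟨hi, if ∃ v ∈ S, Orthogonal v u then 1 else 0, ?_, ?_⟩
          · have := hbm k _ hk hB (mask (W k)ᶜ u) (mask_mem_patterns _ u)
            simp only [mask_or_mask_compl, num'] at this
            rwa [sum_mask_mul (hwt' k)] at this
          · have h10 : (1 : BitVec w) ≠ 0 := by
              intro h
              have := congrArg BitVec.toNat h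
              simp [hw.ne'] at this
            rw [if_pos hB]
            split_ifs with h <;> simp only [h, h10, ne_eq, not_true, not_false_eq_true]
        · left
          rw [if_neg hB] at hi
          refine ⟨(G k (mask (W k) u)).toList, ?_, ?_, hlist k _ hk hB, ?_⟩
          · simpa using hM k hB
          · simpa using hi
          · simp [hB]
    have hrun := runs_evalArrays (N := N) (M := fun j => if h : j < N then M (e.symm ⟨j, h⟩) else 0)
      (X := fun j => ∃ h : j < N,
        if B (e.symm ⟨j, h⟩) (mask (W (e.symm ⟨j, h⟩)) u) then ∃ v ∈ S, Orthogonal v u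
          else ∃ v ∈ G (e.symm ⟨j, h⟩) (mask (W (e.symm ⟨j, h⟩)) u), Orthogonal v u)
      hs hd hw (by omega) hd0 hN1 (u := u) (by
        intro j hj
        have := hX (e.symm ⟨j, hj⟩)
        simpa [hj] using this)
    refine hrun.mono ?_ ?_
    · rw [Finset.sum_range, ← Equiv.sum_comp e]
      simp
    · intro σ hσ
      rw [hσ]
      constructor
      · rintro ⟨j, hj, _, h⟩
        exact ⟨_, h⟩
      · rintro ⟨k, h⟩
        exact ⟨e k, (e k).2, (e k).2, by simpa using h⟩

end OVIndexing

/-! ### Counting ones, list lengths and bitmaps -/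

namespace OVIndexing

open WordRAM

theorem exists_isDivision {d m₁ : ℕ} (b m₂ : ℕ) (h : m₂ ≤ m₁) (R : Finset (Vec d)) :
    ∃ part : Vec d → Finset (Fin m₁), IsDivision b m₂ R part := by
  have key : ∀ v : Vec d, ∃ J : Finset (Fin m₁), J.card = m₂ ∧ ∀ J' : Finset (Fin m₁),
      J'.card = m₂ → onesOn (blockCoords d b J') v ≤ onesOn (blockCoords d b J) v := by
    intro v
    obtain ⟨J, hJ, hmax⟩ := Finset.exists_max_image
      (Finset.powersetCard m₂ (Finset.univ : Finset (Fin m₁)))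
      (fun J => onesOn (blockCoords d b J) v) (by
        rw [Finset.powersetCard_nonempty]; simpa using h)
    simp only [Finset.mem_powersetCard_univ] at hJ hmax
    exact ⟨J, hJ, hmax⟩
  choose part hpart using key
  exact ⟨part, fun v _ => hpart v⟩

theorem mem_blockCoords {d b m₁ : ℕ} {J : Finset (Fin m₁)} {i : Fin d} :
    i ∈ blockCoords d b J ↔ ∃ j ∈ J, (j : ℕ) * b ≤ i ∧ (i : ℕ) < ((j : ℕ) + 1) * b := by
  simp [blockCoords]

theorem block_unique {b i j j' : ℕ} (h : j * b ≤ i) (h' : i < (j + 1) * b) (h₁ : j' * b ≤ i)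
    (h₁' : i < (j' + 1) * b) : j = j' := by
  have h2 : j < j' + 1 := lt_of_mul_lt_mul_right (h.trans_lt h₁') (Nat.zero_le b)
  have h3 : j' < j + 1 := lt_of_mul_lt_mul_right (h₁.trans_lt h') (Nat.zero_le b)
  omega

theorem card_blockCoords {d b m₁ : ℕ} (h : m₁ * b ≤ d) (J : Finset (Fin m₁)) :
    (blockCoords d b J).card = J.card * b := by
  have hlt : ∀ x : Fin m₁ × Fin b, (x.1 : ℕ) * b + x.2 < ((x.1 : ℕ) + 1) * b := fun x => by
    rw [add_mul, one_mul]; omega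
  have hd : ∀ x : Fin m₁ × Fin b, (x.1 : ℕ) * b + x.2 < d := fun x =>
    (hlt x).trans_le ((Nat.mul_le_mul_right b x.1.2).trans h)
  have : (J ×ˢ (Finset.univ : Finset (Fin b))).card = (blockCoords d b J).card := by
    refine Finset.card_nbij (fun x => ⟨(x.1 : ℕ) * b + x.2, hd x⟩) ?_ ?_ ?_
    · intro x hx
      exact mem_blockCoords.2 ⟨x.1, (Finset.mem_product.1 hx).1, Nat.le_add_right _ _, hlt x⟩
    · intro x _ y _ hxy
      have hxy' : (x.1 : ℕ) * b + x.2 = (y.1 : ℕ) * b + y.2 := congrArg Fin.val hxy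
      have h1 : (x.1 : ℕ) = y.1 := block_unique (Nat.le_add_right _ (x.2 : ℕ)) (hlt x)
        (hxy' ▸ Nat.le_add_right _ _) (hxy' ▸ hlt y)
      rw [h1] at hxy'
      exact Prod.ext (Fin.ext h1) (Fin.ext (by omega))
    · intro i hi
      obtain ⟨j, hj, h1, h2⟩ := mem_blockCoords.1 hi
      rw [add_mul, one_mul] at h2
      exact ⟨(j, ⟨i - j * b, by omega⟩), by simpa using hj, Fin.ext (by simp; omega)⟩
  rw [← this, Finset.card_product, Finset.card_univ, Fintype.card_fin]

theorem onesOn_blockCoords {d b m₁ : ℕ} (J : Finset (Fin m₁)) (v : Vec d) :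
    onesOn (blockCoords d b J) v = ∑ j ∈ J, onesOn (blockCoords d b {j}) v := by
  have : blockCoords d b J = J.biUnion fun j => blockCoords d b {j} := by
    ext i
    simp [mem_blockCoords]
  rw [onesOn, this, Finset.sum_biUnion]
  · rfl
  · intro j _ j' _ hne
    refine Finset.disjoint_left.2 fun i hi hi' => hne ?_
    simp only [mem_blockCoords, Finset.mem_singleton, exists_eq_left] at hi hi'
    exact Fin.ext (block_unique hi.1 hi.2 hi'.1 hi'.2)

theorem onesOn_le_card {d : ℕ} (W : Finset (Fin d)) (v : Vec d) : onesOn W v ≤ W.card := by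
  rw [onesOn, Finset.card_eq_sum_ones]
  exact Finset.sum_le_sum fun i _ => Bool.toNat_le _

theorem ones_le_add {d b m₁ : ℕ} (h : m₁ * b ≤ d) (v : Vec d) :
    ones v ≤ onesOn (blockCoords d b (Finset.univ : Finset (Fin m₁))) v + (d - m₁ * b) := by
  set W := blockCoords d b (Finset.univ : Finset (Fin m₁)) with hW
  have h1 : ones v = onesOn W v + onesOn Wᶜ v := (Finset.sum_add_sum_compl W _).symm
  have h2 := onesOn_le_card Wᶜ v
  rw [Finset.card_compl, hW, card_blockCoords h, ← hW] at h2
  simp only [Fintype.card_fin, Finset.card_univ] at h2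
  omega

/-- A choice of `m₂` of `m₁` blocks with the largest number of ones contains at least the
proportional part of all ones. -/
theorem mul_onesOn_le {d b m₁ m₂ : ℕ} {v : Vec d} {J : Finset (Fin m₁)} (hJ : J.card = m₂)
    (hmax : ∀ J' : Finset (Fin m₁), J'.card = m₂ →
      onesOn (blockCoords d b J') v ≤ onesOn (blockCoords d b J) v) :
    m₂ * onesOn (blockCoords d b (Finset.univ : Finset (Fin m₁))) v ≤
      m₁ * onesOn (blockCoords d b J) v := by
  set o : Fin m₁ → ℕ := fun j => onesOn (blockCoords d b {j}) v with ho
  -- Exchange argument: replacing j by j' gives another choice of m₂ blocks, which cannot contain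
  -- more ones.
  have hex : ∀ j ∈ J, ∀ j' ∈ Jᶜ, o j' ≤ o j := by
    intro j hj j' hj'
    rw [Finset.mem_compl] at hj'
    have hni : j' ∉ J.erase j := fun h => hj' (Finset.mem_of_mem_erase h)
    have h1 := hmax (insert j' (J.erase j)) (by
      rw [Finset.card_insert_of_notMem hni, Finset.card_erase_add_one hj, hJ])
    rw [onesOn_blockCoords, onesOn_blockCoords (J := J), Finset.sum_insert hni,
      ← Finset.add_sum_erase J _ hj] at h1
    exact Nat.le_of_add_le_add_right h1
  -- Summing over all pairs yields m₂ · (ones outside J) ≤ (m₁ - m₂) · (ones in J).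
  have hsum : ∑ j ∈ J, ∑ j' ∈ Jᶜ, o j' ≤ ∑ j ∈ J, ∑ j' ∈ Jᶜ, o j :=
    Finset.sum_le_sum fun j hj => Finset.sum_le_sum fun j' hj' => hex j hj j' hj'
  simp only [Finset.sum_const, smul_eq_mul, ← Finset.mul_sum, hJ, Finset.card_compl,
    Fintype.card_fin] at hsum
  have hm : m₂ ≤ m₁ := by simpa [hJ] using Finset.card_le_univ J
  rw [onesOn_blockCoords, onesOn_blockCoords (J := J), ← Finset.sum_add_sum_compl J, mul_add]
  calc m₂ * ∑ j ∈ J, o j + m₂ * ∑ j ∈ Jᶜ, o j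
      ≤ m₂ * ∑ j ∈ J, o j + (m₁ - m₂) * ∑ j ∈ J, o j := by gcongr
    _ = m₁ * ∑ j ∈ J, o j := by rw [← add_mul, Nat.add_sub_cancel' hm]

/-- At most d - m₁b ones can lie outside the blocks; the best m₂ blocks get the proportional share
of the remaining ones. -/
theorem div_le_onesOn_part {d b m₁ m₂ t : ℕ} (h : m₁ * b ≤ d) {S : Finset (Vec d)}
    {part : Vec d → Finset (Fin m₁)} (hpart : IsDivision b m₂ (manyOnes t S) part) {v : Vec d}
    (hv : v ∈ manyOnes t S) :
    m₂ * (t + 1 - (d - m₁ * b)) / m₁ ≤ onesOn (blockCoords d b (part v)) v := by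
  obtain ⟨hJ, hmax⟩ := hpart v hv
  have h1 := mul_onesOn_le hJ hmax
  have h2 := ones_le_add h v
  have h3 : t < ones v := (Finset.mem_filter.1 hv).2
  refine Nat.div_le_of_le_mul (le_trans ?_ h1)
  exact Nat.mul_le_mul_left _ (by omega)

open scoped Classical in
theorem card_patterns {d : ℕ} (W : Finset (Fin d)) :
    (Finset.univ.filter fun a : Vec d => a ∈ patterns W).card = 2 ^ W.card := by
  obtain ⟨wt, -, hb⟩ := exists_weights W
  rw [← Finset.card_range (2 ^ W.card)]
  refine Finset.card_nbij (fun a : Vec d => ∑ i, (a i).toNat * wt i) ?_ ?_ ?_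
  · intro a ha
    simpa using hb.mapsTo (by simpa using ha)
  · simpa using hb.injOn
  · simpa using hb.surjOn

-- The ones of v in W force zeros in the pattern, and the other coordinates of W stay free.
open scoped Classical in
theorem card_patterns_orthogonal {d : ℕ} (W : Finset (Fin d)) (v : Vec d) :
    (Finset.univ.filter fun a : Vec d => a ∈ patterns W ∧ innerOn W v a = 0).card =
      2 ^ (W.card - onesOn W v) := by
  have h1 : (Finset.univ.filter fun a : Vec d => a ∈ patterns W ∧ innerOn W v a = 0) =
      Finset.univ.filter fun a : Vec d => a ∈ patterns (W.filter fun i => v i = false) := by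
    ext a
    simp only [patterns, innerOn, Finset.mem_filter, Finset.mem_univ, true_and, Set.mem_ofPred_eq,
      Finset.sum_eq_zero_iff, mul_eq_zero, Bool.toNat_eq_zero, not_and, Bool.not_eq_false]
    constructor
    · rintro ⟨h, h'⟩ i hi
      by_cases hW : i ∈ W
      · rcases h' i hW with h0 | h0
        · simp [hi hW] at h0
        · exact h0
      · exact h i hW
    · intro h
      refine ⟨fun i hi => h i fun h' => absurd h' hi, fun i hi => ?_⟩
      cases hv : v i
      · exact .inl rfl
      · exact .inr (h i fun _ => hv)
  have h2 : (W.filter fun i => v i = false).card + onesOn W v = W.card := by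
    rw [onesOn, Finset.card_filter, ← Finset.sum_add_distrib, Finset.card_eq_sum_ones]
    exact Finset.sum_congr rfl fun i _ => by cases v i <;> rfl
  rw [h1, card_patterns, ← h2, Nat.add_sub_cancel]

open scoped Classical in
/-- The total length of all lists in all arrays. -/
theorem sum_card_entryList_le {d b m₁ m₂ h : ℕ} (hd : m₁ * b ≤ d) {R : Finset (Vec d)}
    {part : Vec d → Finset (Fin m₁)} (hpart : ∀ v ∈ R, (part v).card = m₂)
    (hh : ∀ v ∈ R, h ≤ onesOn (blockCoords d b (part v)) v) :
    ∑ J : {J : Finset (Fin m₁) // J.card = m₂}, ∑ a with a ∈ patterns (blockCoords d b J.1),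
      (entryList b R part J.1 a).card ≤ R.card * 2 ^ (m₂ * b - h) := by
  have h1 : ∀ (J : {J : Finset (Fin m₁) // J.card = m₂}) (a : Vec d),
      (entryList b R part J.1 a).card =
        ∑ v ∈ R, if part v = J.1 ∧ innerOn (blockCoords d b J.1) v a = 0 then 1 else 0 := by
    intro J a
    rw [entryList, Finset.card_filter]
  simp only [h1]
  have h2 : ∀ J : {J : Finset (Fin m₁) // J.card = m₂},
      (∑ a with a ∈ patterns (blockCoords d b J.1), ∑ v ∈ R,
        if part v = J.1 ∧ innerOn (blockCoords d b J.1) v a = 0 then 1 else 0) =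
      ∑ v ∈ R, ∑ a with a ∈ patterns (blockCoords d b J.1),
        if part v = J.1 ∧ innerOn (blockCoords d b J.1) v a = 0 then 1 else 0 :=
    fun J => Finset.sum_comm
  simp only [h2]
  rw [Finset.sum_comm]
  refine (Finset.sum_le_card_nsmul _ _ _ fun v hv => ?_)
  -- After interchanging the sums, a vector is counted only in the array of the part to which it is
  -- assigned.
  rw [Finset.sum_eq_single (⟨part v, hpart v hv⟩ : {J : Finset (Fin m₁) // J.card = m₂})]
  · simp only [true_and]
    rw [← Finset.card_filter, Finset.filter_filter, card_patterns_orthogonal, card_blockCoords hd,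
      hpart v hv]
    exact Nat.pow_le_pow_right (by omega) (Nat.sub_le_sub_left (hh v hv) _)
  · intro J _ hJ
    refine Finset.sum_eq_zero fun a _ => if_neg fun h' => hJ (Subtype.ext h'.1.symm)
  · intro h'
    exact absurd (Finset.mem_univ _) h'

/-- The data structure DivideByOnes, its size, and the running time of a query. There are `Bm`
bitmaps. -/
theorem exists_divideByOnes {d t b m₁ m₂ L : ℕ} (hd : m₁ * b ≤ d) (hm₂ : m₂ ≤ m₁)
    (S : Finset (Vec d)) :
    ∃ s Bm : ℕ,
      Bm * (L + 1) ≤ S.card * 2 ^ (m₂ * b - m₂ * (t + 1 - (d - m₁ * b)) / m₁) ∧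
      s ≤ 4 + (m₁.choose m₂ + 1) * (2 * d + 3) + S.card + m₁.choose m₂ * (2 * 2 ^ (m₂ * b)) +
        S.card * 2 ^ (m₂ * b - m₂ * (t + 1 - (d - m₁ * b)) / m₁) + Bm * 2 ^ (d - m₂ * b) ∧
      ∀ w, s < 2 ^ w → d ≤ w → 0 < w → ∃ mem : Fin s → BitVec w,
        HoldsDivideByOnes t b m₁ m₂ L S mem ∧ ∀ u : Vec d,
          Runs evalArrays (startState mem u)
            ((m₁.choose m₂ + 1) * (130 * (d + 1)) + 20 * (fewOnes t S).card +
              m₁.choose m₂ * (20 * L) + 20)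
            fun σ => σ.reg 0 ≠ 0 ↔ ∃ v ∈ S, Orthogonal v u := by
  classical
  obtain ⟨part, hpart⟩ := exists_isDivision b m₂ hm₂ (manyOnes t S)
  set R := manyOnes t S with hR
  -- The list of sparse vectors is treated as one more array, indexed by the only pattern on the
  -- empty set, so a single loop evaluates everything.
  let κ := Option {J : Finset (Fin m₁) // J.card = m₂}
  let W : κ → Finset (Fin d) := fun k => k.elim ∅ fun J => blockCoords d b J.1
  let G : κ → Vec d → Finset (Vec d) := fun k a =>
    k.elim (fewOnes t S) fun J => entryList b R part J.1 a
  let B : κ → Vec d → Prop := fun k a =>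
    k.elim False fun J => ¬ (entryList b R part J.1 a).card ≤ L
  have hcard : Fintype.card {J : Finset (Fin m₁) // J.card = m₂} = m₁.choose m₂ := by
    rw [Fintype.card_finset_len, Fintype.card_fin]
  have hRS : R.card ≤ S.card := Finset.card_filter_le _ _
  obtain ⟨s, hs, hmem⟩ := exists_arrays S W G B
  set Bm := ∑ J : {J : Finset (Fin m₁) // J.card = m₂},
    ∑ a with a ∈ patterns (blockCoords d b J.1),
      if ¬ (entryList b R part J.1 a).card ≤ L then 1 else 0 with hBm
  have hE : ∑ J : {J : Finset (Fin m₁) // J.card = m₂},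
      ∑ a with a ∈ patterns (blockCoords d b J.1), (entryList b R part J.1 a).card ≤
      S.card * 2 ^ (m₂ * b - m₂ * (t + 1 - (d - m₁ * b)) / m₁) :=
    (sum_card_entryList_le hd (fun v hv => (hpart v hv).1)
      fun v hv => div_le_onesOn_part hd hpart hv).trans (Nat.mul_le_mul_right _ hRS)
  refine ⟨s, Bm, le_trans ?_ hE, hs.trans ?_, ?_⟩
  -- Markov's inequality: every bitmap replaces a list with at least L + 1 members.
  · rw [hBm, Finset.sum_mul]
    refine Finset.sum_le_sum fun J _ => ?_
    rw [Finset.sum_mul]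
    refine Finset.sum_le_sum fun a _ => ?_
    split_ifs <;> omega
  · have hfew : (fewOnes t S).card ≤ S.card := Finset.card_filter_le _ _
    have hnone : (Finset.univ.filter fun a : Vec d => a ∈ patterns (∅ : Finset (Fin d))).card = 1 := by
      rw [card_patterns]; rfl
    have hJ : ∀ J : {J : Finset (Fin m₁) // J.card = m₂},
        2 * d + 2 ^ (W (some J)).card + ∑ a with a ∈ patterns (W (some J)),
          (1 + if B (some J) a then 2 ^ (W (some J))ᶜ.card else (G (some J) a).card) ≤
        2 * d + 2 * 2 ^ (m₂ * b) +
          ∑ a with a ∈ patterns (blockCoords d b J.1), (entryList b R part J.1 a).card +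
          (∑ a with a ∈ patterns (blockCoords d b J.1),
            if ¬ (entryList b R part J.1 a).card ≤ L then 1 else 0) * 2 ^ (d - m₂ * b) := by
      intro J
      have hc : (blockCoords d b J.1).card = m₂ * b := by rw [card_blockCoords hd, J.2]
      have hc' : (blockCoords d b J.1)ᶜ.card = d - m₂ * b := by
        rw [Finset.card_compl, hc, Fintype.card_fin]
      rw [show W (some J) = blockCoords d b J.1 from rfl, Finset.sum_add_distrib,
        ← Finset.card_eq_sum_ones, card_patterns, hc, hc', Finset.sum_mul]
      have : ∀ a : Vec d, (if B (some J) a then 2 ^ (d - m₂ * b) else (G (some J) a).card) ≤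
          (entryList b R part J.1 a).card +
          (if ¬ (entryList b R part J.1 a).card ≤ L then 1 else 0) * 2 ^ (d - m₂ * b) := by
        intro a
        by_cases hL : (entryList b R part J.1 a).card ≤ L
        · rw [if_neg fun h : B (some J) a => h hL]
          exact Nat.le_add_right _ _
        · rw [if_pos (show B (some J) a from hL), if_pos hL, one_mul]
          exact Nat.le_add_left _ _
      have h2 := Finset.sum_le_sum (s := Finset.univ.filter
        fun a : Vec d => a ∈ patterns (blockCoords d b J.1)) fun a _ => this a
      rw [Finset.sum_add_distrib] at h2
      omega
    have hsum := Finset.sum_le_sum (s := Finset.univ) fun J _ => hJ J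
    have hone : 2 * d + 2 ^ (W none).card + ∑ a with a ∈ patterns (W none),
        (1 + if B none a then 2 ^ (W none)ᶜ.card else (G none a).card) =
        2 * d + 1 + (1 + (fewOnes t S).card) := by
      have : ∀ a : Vec d, (if B none a then 2 ^ (W none)ᶜ.card else (G none a).card) =
          (fewOnes t S).card := fun a => if_neg id
      simp only [this]
      rw [Finset.sum_const, show W none = ∅ from rfl, hnone, one_smul, Finset.card_empty, pow_zero]
    rw [Fintype.card_option, hcard, Fintype.sum_option, hone]
    have hsum' : ∑ J : {J : Finset (Fin m₁) // J.card = m₂}, (2 * d + 2 * 2 ^ (m₂ * b) +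
          ∑ a with a ∈ patterns (blockCoords d b J.1), (entryList b R part J.1 a).card +
          (∑ a with a ∈ patterns (blockCoords d b J.1),
            if ¬ (entryList b R part J.1 a).card ≤ L then 1 else 0) * 2 ^ (d - m₂ * b)) =
        m₁.choose m₂ * (2 * d + 2 * 2 ^ (m₂ * b)) +
        ∑ J : {J : Finset (Fin m₁) // J.card = m₂},
          ∑ a with a ∈ patterns (blockCoords d b J.1), (entryList b R part J.1 a).card +
        Bm * 2 ^ (d - m₂ * b) := by
      rw [Finset.sum_add_distrib, Finset.sum_add_distrib, ← Finset.sum_mul, ← hBm, Finset.sum_const,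
        Finset.card_univ, hcard, smul_eq_mul]
    rw [hsum'] at hsum
    linarith
  · intro w hsw hdw hw
    obtain ⟨mem, harr, hrun⟩ := hmem w hsw hdw hw
    refine ⟨mem, ⟨?_, part, hpart, ?_⟩, ?_⟩
    · obtain ⟨q, num, -, h⟩ := harr none
      obtain ⟨p, -, hp⟩ := h (fun _ => false) fun _ _ => rfl
      exact ⟨p.toNat, by simpa [B, G] using hp⟩
    · intro J hJ
      obtain ⟨q, num, hb, h⟩ := harr (some ⟨J, hJ⟩)
      refine ⟨q, num, hb, fun a ha => ?_⟩
      obtain ⟨p, hp, hp'⟩ := h a ha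
      refine ⟨p, hp, ?_⟩
      by_cases hL : (entryList b R part J a).card ≤ L
      · rw [if_neg fun h : B (some ⟨J, hJ⟩) a => h hL] at hp'
        rw [if_pos hL]
        exact hp'
      · rw [if_pos (show B (some ⟨J, hJ⟩) a from hL)] at hp'
        rw [if_neg hL]
        exact hp'
    · intro u
      refine (hrun u (fun k => k.elim (fewOnes t S).card fun _ => L) ?_).mono ?_ ?_
      · rintro (_ | J) h
        · simp [G]
        · simpa [B, G] using h
      · rw [Fintype.sum_option]
        simp only [Option.elim_none, Option.elim_some, Finset.sum_const, Finset.card_univ, hcard,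
          smul_eq_mul]
        linarith
      · intro σ hσ
        rw [hσ]
        constructor
        · rintro ⟨_ | J, hk⟩
          · rw [if_neg (show ¬ B none (mask (W none) u) from id)] at hk
            obtain ⟨v, hv, ho⟩ := hk
            exact ⟨v, (Finset.mem_filter.1 hv).1, ho⟩
          · split_ifs at hk
            · exact hk
            · obtain ⟨v, hv, ho⟩ := hk
              exact ⟨v, (Finset.mem_filter.1 (Finset.mem_filter.1 hv).1).1, ho⟩
        · rintro ⟨v, hv, ho⟩
          by_cases ht : ones v ≤ t
          · refine ⟨none, ?_⟩
            rw [if_neg (show ¬ B none (mask (W none) u) from id)]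
            exact ⟨v, Finset.mem_filter.2 ⟨hv, ht⟩, ho⟩
          · have hvR : v ∈ R := Finset.mem_filter.2 ⟨hv, not_le.1 ht⟩
            refine ⟨some ⟨part v, (hpart v hvR).1⟩, ?_⟩
            split_ifs
            · exact ⟨v, hv, ho⟩
            · refine ⟨v, Finset.mem_filter.2 ⟨hvR, rfl, ?_⟩, ho⟩
              -- Orthogonality to u on all coordinates restricts to the blocks of the part, so v is
              -- in the list that the query reads.
              rw [orthogonal_iff] at ho
              refine Finset.sum_eq_zero fun i hi => ?_
              have := ho i
              cases hvi : v i <;> simp_all [mask]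

end OVIndexing

/-! ### Binomial estimates and the choice of parameters -/

namespace OVIndexing

open WordRAM

theorem two_rpow_mul_logb {n : ℕ} (hn : 1 ≤ n) (y : ℝ) :
    (2 : ℝ) ^ (y * Real.logb 2 n) = (n : ℝ) ^ y := by
  rw [mul_comm, Real.rpow_mul (by norm_num), Real.rpow_logb (by norm_num) (by norm_num)
    (by exact_mod_cast hn)]

theorem logb_nonneg {n : ℕ} (hn : 1 ≤ n) : 0 ≤ Real.logb 2 n :=
  Real.logb_nonneg (by norm_num) (by exact_mod_cast hn)

/-- Every power `2 ^ m` is bounded by the power of `n` that bounds the exponent `m`. -/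
theorem two_pow_le {n m : ℕ} (hn : 1 ≤ n) {y z : ℝ} (h : (m : ℝ) ≤ y * Real.logb 2 n + z) :
    (2 : ℝ) ^ m ≤ 2 ^ z * (n : ℝ) ^ y := by
  rw [← two_rpow_mul_logb hn, ← Real.rpow_add (by norm_num), ← Real.rpow_natCast]
  exact Real.rpow_le_rpow_of_exponent_le (by norm_num) (by linarith)

theorem exists_logb_le {a : ℝ} (ha : 0 < a) :
    ∃ C : ℝ, 0 ≤ C ∧ ∀ n : ℕ, 1 ≤ n → Real.logb 2 n ≤ C * (n : ℝ) ^ a := by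
  have h2 : 0 < Real.log 2 := Real.log_pos (by norm_num)
  refine ⟨1 / (a * Real.log 2), by positivity, fun n hn => ?_⟩
  have h := Real.log_natCast_le_rpow_div n ha
  rw [Real.logb, div_le_iff₀ h2]
  calc Real.log n ≤ (n : ℝ) ^ a / a := h
    _ = _ := by field_simp

theorem choose_le_choose_of_le_half {d i t : ℕ} (hi : i ≤ t) (ht : 2 * t ≤ d) :
    d.choose i ≤ d.choose t := by
  induction t, hi using Nat.le_induction with
  | base => exact le_rfl
  | succ t _ ih => exact (ih (by omega)).trans (Nat.choose_le_succ_of_lt_half_left (by omega))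

/-- Below the middle, binomial coefficients increase, so each of the t + 1 layers has at most as
many vectors as layer t. -/
theorem card_fewOnes_le {d t : ℕ} (ht : 2 * t ≤ d) (S : Finset (Vec d)) :
    (fewOnes t S).card ≤ (t + 1) * d.choose t := by
  have h1 : (fewOnes t S).card ≤ ((Finset.range (t + 1)).biUnion fun i =>
      Finset.powersetCard i (Finset.univ : Finset (Fin d))).card := by
    refine Finset.card_le_card_of_injOn (fun v => Finset.univ.filter fun i => v i = true) ?_ ?_
    · intro v hv
      have hv' : ones v ≤ t := (Finset.mem_filter.1 hv).2
      have : (Finset.univ.filter fun i => v i = true).card = ones v := by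
        rw [Finset.card_filter, ones, onesOn]
        exact Finset.sum_congr rfl fun i _ => by cases v i <;> rfl
      rw [Finset.mem_coe, Finset.mem_biUnion]
      exact ⟨ones v, Finset.mem_range.2 (by omega), Finset.mem_powersetCard_univ.2 this⟩
    · intro v _ v' _ h
      funext i
      exact Bool.eq_iff_iff.2 (by simpa using Finset.ext_iff.1 h i)
  refine h1.trans (Finset.card_biUnion_le.trans ?_)
  refine (Finset.sum_le_card_nsmul _ _ (d.choose t) fun i hi => ?_).trans (by simp)
  rw [Finset.card_powersetCard, Finset.card_univ, Fintype.card_fin]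
  exact choose_le_choose_of_le_half (by simpa [Nat.lt_succ_iff] using hi) ht

/-- It suffices to treat d = 2t, where the central binomial coefficient is at least 4^t / (2t) and
2t ≤ 2^t. -/
theorem two_pow_le_choose {d t : ℕ} (ht : 2 * t ≤ d) : 2 ^ t ≤ d.choose t := by
  refine le_trans ?_ (Nat.choose_le_choose t ht)
  change 2 ^ t ≤ t.centralBinom
  rcases Nat.eq_zero_or_pos t with rfl | hpos
  · simp
  have h1 := Nat.four_pow_le_two_mul_self_mul_centralBinom t hpos
  have h2 : 2 * t ≤ 2 ^ t := by
    obtain ⟨k, rfl⟩ : ∃ k, t = k + 1 := ⟨t - 1, by omega⟩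
    rw [pow_succ']
    exact Nat.mul_le_mul_left 2 Nat.lt_two_pow_self
  have h3 : 2 ^ t * 2 ^ t ≤ 2 ^ t * t.centralBinom := by
    rw [← mul_pow]
    exact h1.trans (Nat.mul_le_mul_right _ h2)
  exact Nat.le_of_mul_le_mul_left h3 (by positivity)

theorem two_mul_floor_le_dim {c x : ℝ} (hx : x ≤ c / 2) {n : ℕ} (hn : 1 ≤ n) :
    2 * ⌊x * Real.logb 2 n⌋₊ ≤ dim c n := by
  rcases le_or_gt x 0 with h0 | h0
  · rw [Nat.floor_of_nonpos (mul_nonpos_of_nonpos_of_nonneg h0 (logb_nonneg hn))]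
    simp
  refine Nat.le_floor ?_
  push_cast
  have h1 := Nat.floor_le (mul_nonneg h0.le (logb_nonneg hn))
  nlinarith [logb_nonneg hn]

/-- Half of δ absorbs the soft-O factor, leaving an honest constant that is valid for all n ≥ 1. -/
theorem sparseThresholds_bound {c x : ℝ} (hx : x ∈ sparseThresholds c) :
    ∃ δ : ℝ, 0 < δ ∧ ∃ C : ℝ, 0 < C ∧ ∀ n : ℕ, 1 ≤ n →
      ((dim c n).choose ⌊x * Real.logb 2 n⌋₊ : ℝ) ≤ C * (n : ℝ) ^ (1 - δ) := by
  obtain ⟨-, -, δ, hδ, h⟩ := hx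
  obtain ⟨C, hC, hb⟩ := bound_of_isBigO_nat_atTop (h (δ / 2) (by positivity))
  refine ⟨δ / 2, by positivity, C, hC, fun n hn => ?_⟩
  have hn' : (0 : ℝ) < n := by exact_mod_cast hn
  have heq : (n : ℝ) ^ (1 - δ) * (n : ℝ) ^ (δ / 2) = (n : ℝ) ^ (1 - δ / 2) := by
    rw [← Real.rpow_add hn']; ring_nf
  have := hb (x := n) (by positivity)
  rw [heq] at this
  rwa [Real.norm_of_nonneg (by positivity), Real.norm_of_nonneg (by positivity)] at this

/-- The binomial coefficient is at least 2^t ≥ n^x / 2, which outgrows n^(1-δ) if x > 1. The bound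
gives κ ≤ 1, needed to compare the array sizes 2^M ≤ n^(c-1) with the space bound. -/
theorem le_one_of_mem_sparseThresholds {c x : ℝ} (hx : x ∈ sparseThresholds c) : x ≤ 1 := by
  obtain ⟨δ, hδ, C, hC, h⟩ := sparseThresholds_bound hx
  by_contra hx1
  have hlim : Tendsto (fun n : ℕ => (n : ℝ) ^ (x - 1 + δ)) atTop atTop :=
    (tendsto_rpow_atTop (by linarith)).comp tendsto_natCast_atTop_atTop
  obtain ⟨n, hn, hn1⟩ := ((hlim.eventually_gt_atTop (2 * C)).and (eventually_ge_atTop 1)).exists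
  have hn' : (0 : ℝ) < n := by exact_mod_cast hn1
  have h1 := h n hn1
  have h2 : (2 : ℝ) ^ ⌊x * Real.logb 2 n⌋₊ ≤ C * (n : ℝ) ^ (1 - δ) :=
    le_trans (by exact_mod_cast two_pow_le_choose (two_mul_floor_le_dim hx.2.1 hn1)) h1
  have h3 : (n : ℝ) ^ x ≤ 2 * 2 ^ ⌊x * Real.logb 2 n⌋₊ := by
    rw [← two_rpow_mul_logb hn1, ← pow_succ', ← Real.rpow_natCast]
    refine Real.rpow_le_rpow_of_exponent_le (by norm_num) ?_
    push_cast
    exact (Nat.lt_floor_add_one _).le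
  have h4 : (n : ℝ) ^ (x - 1 + δ) * (n : ℝ) ^ (1 - δ) = (n : ℝ) ^ x := by
    rw [← Real.rpow_add hn']; ring_nf
  have h5 : (0 : ℝ) < (n : ℝ) ^ (1 - δ) := by positivity
  nlinarith

/-- At η = 0 and x = c₁ the inequality reads (c₁-ε)(c-1-ε) < c₁(c-1). It is strict, so it persists
for x slightly below c₁ and then, by continuity, for small η > 0. -/
theorem exists_parameters {c c₁ ε : ℝ} (hc : 1 < c) (hc₁ : IsLUB (sparseThresholds c) c₁)
    (hε : 0 < ε) (hε' : ε ≤ max c₁ (c - 1)) :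
    ∃ x ∈ sparseThresholds c, ∃ η : ℝ, 0 < η ∧ η < x ∧ η < c - 1 ∧
      (c₁ - ε) / c * (c - 1 - ε) + η < (c - 1 - η) / c * (x - η) := by
  have hc0 : 0 < c := by linarith
  -- The empty set has no least upper bound in ℝ, so admissible thresholds exist.
  have hne : (sparseThresholds c).Nonempty := by
    by_contra h
    rw [Set.not_nonempty_iff_eq_empty] at h
    rw [h, isLUB_empty_iff] at hc₁
    exact absurd (hc₁ (c₁ - 1)) (by linarith)
  obtain ⟨x₀, hx₀⟩ := hne
  have hc₁0 : 0 < c₁ := hx₀.1.trans_le (hc₁.1 hx₀)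
  have hlt : (c₁ - ε) * (c - 1 - ε) < c₁ * (c - 1) := by
    have hp : 0 < c₁ * (c - 1) := mul_pos hc₁0 (by linarith)
    rcases le_total ε c₁ with h1 | h1 <;> rcases le_total ε (c - 1) with h2 | h2
    · nlinarith
    · nlinarith
    · nlinarith
    -- Two negative factors could have a large product; the bound on ε forces one of them to be zero
    -- here.
    · rcases le_max_iff.1 hε' with h | h
      · nlinarith
      · nlinarith
  set θ := (c₁ - ε) / c * (c - 1 - ε) with hθ
  have hθc : θ * c / (c - 1) < c₁ := by
    rw [div_lt_iff₀ (by linarith), hθ]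
    calc (c₁ - ε) / c * (c - 1 - ε) * c = (c₁ - ε) * (c - 1 - ε) := by field_simp
      _ < _ := hlt
  obtain ⟨x, hx, hθx, -⟩ := hc₁.exists_between hθc
  have h0 : θ + 0 < (c - 1 - 0) / c * (x - 0) := by
    rw [div_lt_iff₀ (by linarith)] at hθx
    rw [add_zero, sub_zero, sub_zero, div_mul_eq_mul_div, lt_div_iff₀ hc0]
    linarith
  have hcont : ∀ᶠ η in nhds (0 : ℝ), θ + η < (c - 1 - η) / c * (x - η) := by
    have h1 : Continuous fun η : ℝ => θ + η := by fun_prop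
    have h2 : Continuous fun η : ℝ => (c - 1 - η) / c * (x - η) := by fun_prop
    exact (isOpen_lt h1 h2).mem_nhds h0
  have hall := ((hcont.and ((eventually_lt_nhds hx.1).and
    (eventually_lt_nhds (show (0 : ℝ) < c - 1 by linarith)))).filter_mono
    (nhdsWithin_le_nhds (s := Set.Ioi 0))).and self_mem_nhdsWithin
  obtain ⟨η, ⟨h1, h2, h3⟩, h4⟩ := hall.exists
  exact ⟨x, hx, η, h4, h2, h3, h1⟩

end OVIndexing

/-! ### Rounding, size, time and word length -/

namespace OVIndexing

open WordRAM

theorem dim_le {c : ℝ} (hc : 0 ≤ c) {n : ℕ} (hn : 1 ≤ n) : (dim c n : ℝ) ≤ c * Real.logb 2 n :=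
  Nat.floor_le (mul_nonneg hc (logb_nonneg hn))

theorem floor_mul_floor_le {y η : ℝ} (hy : 0 ≤ y) (hη : 0 < η) {n : ℕ} (hn : 1 ≤ n) :
    (⌊y / η⌋₊ * ⌊η * Real.logb 2 n⌋₊ : ℝ) ≤ y * Real.logb 2 n := by
  have h1 : (⌊y / η⌋₊ : ℝ) ≤ y / η := Nat.floor_le (by positivity)
  have h2 := Nat.floor_le (mul_nonneg hη.le (logb_nonneg hn))
  calc (⌊y / η⌋₊ * ⌊η * Real.logb 2 n⌋₊ : ℝ) ≤ y / η * (η * Real.logb 2 n) := by gcongr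
    _ = _ := by field_simp

/-- Rounding the number of blocks loses at most one block, that is ηℓ; rounding the block length
loses at most one coordinate per block, that is y/η in total. -/
theorem le_floor_mul_floor {y η : ℝ} (hy : 0 ≤ y) (hη : 0 < η) {n : ℕ} (hn : 1 ≤ n) :
    (y - η) * Real.logb 2 n - y / η ≤ (⌊y / η⌋₊ * ⌊η * Real.logb 2 n⌋₊ : ℝ) := by
  have hℓ := logb_nonneg hn
  have h1 : (⌊y / η⌋₊ : ℝ) ≤ y / η := Nat.floor_le (by positivity)
  have h1' := Nat.lt_floor_add_one (y / η)
  have h2 := (Nat.lt_floor_add_one (η * Real.logb 2 n)).le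
  have h3 : (⌊y / η⌋₊ : ℝ) * (η * Real.logb 2 n - 1) ≤ ⌊y / η⌋₊ * ⌊η * Real.logb 2 n⌋₊ := by
    gcongr
    linarith
  have h4 : (y / η - 1) * (η * Real.logb 2 n) ≤ ⌊y / η⌋₊ * (η * Real.logb 2 n) := by
    gcongr
    linarith
  have h5 : (y / η - 1) * (η * Real.logb 2 n) = (y - η) * Real.logb 2 n := by
    field_simp
  linarith

theorem blocks_le_dim {c η : ℝ} (hc : 0 ≤ c) (hη : 0 < η) {n : ℕ} (hn : 1 ≤ n) :
    ⌊c / η⌋₊ * ⌊η * Real.logb 2 n⌋₊ ≤ dim c n :=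
  Nat.le_floor (by push_cast; exact floor_mul_floor_le hc hη hn)

/-- A lower bound for the number of ones in the part to which a vector is assigned. -/
theorem le_ones_part {c x η : ℝ} (hc : 1 < c) (hη : 0 < η) (hηx : η < x) (hηc : η < c - 1)
    (hxc : x ≤ c / 2) {n : ℕ} (hn : 1 ≤ n) :
    (c - 1 - η) / c * (x - η) * Real.logb 2 n - (c / η + 1) ≤
      ((min (⌊(c - 1) / η⌋₊ * (⌊x * Real.logb 2 n⌋₊ + 1 -
          (dim c n - ⌊c / η⌋₊ * ⌊η * Real.logb 2 n⌋₊)) / ⌊c / η⌋₊)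
        (⌊(c - 1) / η⌋₊ * ⌊η * Real.logb 2 n⌋₊) : ℕ) : ℝ) := by
  set ℓ := Real.logb 2 n with hℓdef
  have hℓ : 0 ≤ ℓ := logb_nonneg hn
  have hc0 : 0 < c := by linarith
  set m₁ := ⌊c / η⌋₊ with hm₁
  set m₂ := ⌊(c - 1) / η⌋₊ with hm₂
  set b := ⌊η * ℓ⌋₊ with hb
  set t := ⌊x * ℓ⌋₊ with ht
  have hm₁0 : 0 < m₁ := Nat.floor_pos.2 ((one_le_div hη).2 (by linarith))
  have hm₁0' : (0 : ℝ) < m₁ := by exact_mod_cast hm₁0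
  have hm₁le : (m₁ : ℝ) ≤ c / η := Nat.floor_le (by positivity)
  have hm₂ge : (c - 1) / η - 1 ≤ m₂ := by linarith [Nat.lt_floor_add_one ((c - 1) / η)]
  have hm₂le : (m₂ : ℝ) ≤ m₁ := by
    exact_mod_cast Nat.floor_le_floor (by gcongr; linarith)
  have hmb := blocks_le_dim hc0.le hη hn
  rw [← hm₁, ← hℓdef, ← hb] at hmb
  -- This makes the same lower bound valid for the total block length, the second entry of the
  -- minimum.
  have hmul : (c - 1 - η) / c * (x - η) ≤ c - 1 - η := by
    have h1 : (c - 1 - η) / c * (x - η) ≤ (c - 1 - η) / c * c := by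
      have : 0 ≤ (c - 1 - η) / c := div_nonneg (by linarith) hc0.le
      gcongr
      linarith
    rwa [div_mul_cancel₀ _ hc0.ne'] at h1
  rw [Nat.cast_min, le_min_iff]
  constructor
  · set y := t + 1 - (dim c n - m₁ * b) with hy
    have hy' : (x - η) * ℓ - c / η ≤ (y : ℝ) := by
      have h1 : t + 1 + m₁ * b ≤ y + dim c n := by omega
      have h1' : (t : ℝ) + 1 + m₁ * b ≤ y + dim c n := by exact_mod_cast h1
      have h2 := (Nat.lt_floor_add_one (x * ℓ)).le
      have h3 := le_floor_mul_floor hc0.le hη hn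
      have h4 := dim_le hc0.le hn
      rw [← hℓdef] at h3 h4
      linarith
    have h1 : m₂ * y < m₁ * (m₂ * y / m₁ + 1) := Nat.lt_mul_div_succ _ hm₁0
    have h1' : (m₂ : ℝ) * y ≤ m₁ * ((m₂ * y / m₁ : ℕ) + 1) := by exact_mod_cast h1.le
    -- Worst case of both roundings: m₂ ≥ (c-1)/η - 1 and m₁ ≤ c/η.
    have hq : (c - 1 - η) / c ≤ (m₂ : ℝ) / m₁ := by
      rw [div_le_div_iff₀ hc0 hm₁0']
      calc (c - 1 - η) * m₁ ≤ (c - 1 - η) * (c / η) := by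
            have : 0 ≤ c - 1 - η := by linarith
            gcongr
        _ = ((c - 1) / η - 1) * c := by field_simp
        _ ≤ m₂ * c := by gcongr
    have hq1 : (m₂ : ℝ) / m₁ ≤ 1 := (div_le_one hm₁0').2 hm₂le
    have h2 : (m₂ : ℝ) / m₁ * y ≤ (m₂ * y / m₁ : ℕ) + 1 := by
      rw [div_mul_eq_mul_div, div_le_iff₀ hm₁0', mul_comm _ (m₁ : ℝ)]
      exact h1'
    have h3 : (m₂ : ℝ) / m₁ * ((x - η) * ℓ - c / η) ≤ (m₂ : ℝ) / m₁ * y := by gcongr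
    have h4 : (c - 1 - η) / c * ((x - η) * ℓ) ≤ (m₂ : ℝ) / m₁ * ((x - η) * ℓ) := by
      have : 0 ≤ (x - η) * ℓ := mul_nonneg (by linarith) hℓ
      gcongr
    have h5 : (m₂ : ℝ) / m₁ * (c / η) ≤ 1 * (c / η) := by gcongr
    rw [mul_assoc]
    linarith
  · push_cast
    have h3 := le_floor_mul_floor (show 0 ≤ c - 1 by linarith) hη hn
    rw [← hℓdef, ← hm₂, ← hb] at h3
    have h4 : (c - 1 - η) / c * (x - η) * ℓ ≤ (c - 1 - η) * ℓ := by gcongr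
    have h5 : (c - 1) / η ≤ c / η := by gcongr; linarith
    linarith

/-- The number of words of the data structure. -/
theorem size_le {c x η : ℝ} (hc : 1 < c) (hη : 0 < η) (hηx : η < x) (hηc : η < c - 1)
    (hx1 : x ≤ 1) (hxc : x ≤ c / 2) : ∃ A : ℝ, 0 < A ∧ ∀ n : ℕ, 1 ≤ n → ∀ s Bm : ℕ,
      Bm * (⌊(n : ℝ) ^ (1 - η)⌋₊ + 1) ≤ n * 2 ^ (⌊(c - 1) / η⌋₊ * ⌊η * Real.logb 2 n⌋₊ -
        ⌊(c - 1) / η⌋₊ * (⌊x * Real.logb 2 n⌋₊ + 1 -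
          (dim c n - ⌊c / η⌋₊ * ⌊η * Real.logb 2 n⌋₊)) / ⌊c / η⌋₊) →
      s ≤ 4 + (⌊c / η⌋₊.choose ⌊(c - 1) / η⌋₊ + 1) * (2 * dim c n + 3) + n +
        ⌊c / η⌋₊.choose ⌊(c - 1) / η⌋₊ * (2 * 2 ^ (⌊(c - 1) / η⌋₊ * ⌊η * Real.logb 2 n⌋₊)) +
        n * 2 ^ (⌊(c - 1) / η⌋₊ * ⌊η * Real.logb 2 n⌋₊ -
          ⌊(c - 1) / η⌋₊ * (⌊x * Real.logb 2 n⌋₊ + 1 -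
            (dim c n - ⌊c / η⌋₊ * ⌊η * Real.logb 2 n⌋₊)) / ⌊c / η⌋₊) +
        Bm * 2 ^ (dim c n - ⌊(c - 1) / η⌋₊ * ⌊η * Real.logb 2 n⌋₊) →
      (s : ℝ) ≤ A * (n : ℝ) ^ (c - (c - 1 - η) / c * (x - η) + η) := by
  have hc0 : 0 < c := by linarith
  set κ := (c - 1 - η) / c * (x - η) with hκ
  have hq0 : 0 ≤ (c - 1 - η) / c := div_nonneg (by linarith) hc0.le
  have hq1 : (c - 1 - η) / c ≤ 1 := (div_le_one hc0).2 (by linarith)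
  have hκ1 : κ ≤ 1 := by
    calc κ ≤ 1 * 1 := mul_le_mul hq1 (by linarith) (by linarith) (by norm_num)
      _ = 1 := one_mul 1
  have hκc : κ ≤ c - 1 := by
    have h1 : κ ≤ (c - 1 - η) / c * c := by
      rw [hκ]; gcongr; linarith
    rw [div_mul_cancel₀ _ hc0.ne'] at h1
    linarith
  set N := ⌊c / η⌋₊.choose ⌊(c - 1) / η⌋₊ with hN
  refine ⟨4 + (N + 1) * (2 * c + 3) + 1 + N * 2 + 2 ^ (c / η + 1) + 2 ^ (c / η + 1), by positivity,
    fun n hn s Bm hBm hs => ?_⟩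
  set ℓ := Real.logb 2 n with hℓdef
  have hℓ : 0 ≤ ℓ := logb_nonneg hn
  have hn1 : (1 : ℝ) ≤ n := by exact_mod_cast hn
  have hn0 : (0 : ℝ) < n := by linarith
  have hh := le_ones_part hc hη hηx hηc hxc hn
  have hm₂d : ⌊(c - 1) / η⌋₊ * ⌊η * ℓ⌋₊ ≤ dim c n :=
    (Nat.mul_le_mul_right _ (Nat.floor_le_floor (by gcongr; linarith))).trans
      (blocks_le_dim hc0.le hη hn)
  have hm₂ := floor_mul_floor_le (show 0 ≤ c - 1 by linarith) hη hn
  have hd := dim_le hc0.le hn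
  rw [← hℓdef] at hh hm₂ hd
  rw [← hκ] at hh
  set h := ⌊(c - 1) / η⌋₊ * (⌊x * ℓ⌋₊ + 1 - (dim c n - ⌊c / η⌋₊ * ⌊η * ℓ⌋₊)) / ⌊c / η⌋₊ with hhdef
  set M := ⌊(c - 1) / η⌋₊ * ⌊η * ℓ⌋₊ with hM
  set e := c - κ + η with he
  -- Capping h at M turns the truncated subtraction into a genuine one, which can be cast to ℝ.
  have hmin : M - h = M - min h M := by omega
  rw [hmin] at hBm hs
  set h' := min h M with hh'
  have hh'M : h' ≤ M := min_le_right _ _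
  have hM' : (M : ℝ) ≤ (c - 1) * ℓ := by rw [hM]; push_cast; exact hm₂
  have hpow : ∀ y : ℝ, y ≤ e → (n : ℝ) ^ y ≤ (n : ℝ) ^ e := fun y hy =>
    Real.rpow_le_rpow_of_exponent_le hn1 hy
  have hone : (1 : ℝ) ≤ (n : ℝ) ^ e := by
    simpa using hpow 0 (by linarith)
  have hnpow : (n : ℝ) ≤ (n : ℝ) ^ e := by
    simpa using hpow 1 (by linarith)
  have hℓn : ℓ ≤ n := by
    rw [hℓdef, Real.logb_le_iff_le_rpow (by norm_num) hn0, Real.rpow_natCast]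
    exact_mod_cast Nat.lt_two_pow_self.le
  have hdn : (dim c n : ℝ) ≤ c * (n : ℝ) ^ e :=
    hd.trans (by gcongr; exact hℓn.trans hnpow)
  have hMpow : (2 : ℝ) ^ M ≤ (n : ℝ) ^ e := by
    refine (two_pow_le hn (y := c - 1) (z := 0) (by linarith)).trans ?_
    rw [Real.rpow_zero, one_mul]
    exact hpow _ (by linarith)
  have hMh : (n : ℝ) * 2 ^ (M - h') ≤ 2 ^ (c / η + 1) * (n : ℝ) ^ e := by
    have h1 : (2 : ℝ) ^ (M - h') ≤ 2 ^ (c / η + 1) * (n : ℝ) ^ (c - 1 - κ) := by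
      refine two_pow_le hn ?_
      rw [Nat.cast_sub hh'M]
      linarith
    calc (n : ℝ) * 2 ^ (M - h') ≤ n * (2 ^ (c / η + 1) * (n : ℝ) ^ (c - 1 - κ)) := by gcongr
      _ = 2 ^ (c / η + 1) * (n : ℝ) ^ (c - κ) := by
        rw [show c - κ = 1 + (c - 1 - κ) by ring, Real.rpow_add hn0, Real.rpow_one]; ring
      _ ≤ _ := mul_le_mul_of_nonneg_left (hpow (c - κ) (by linarith)) (by positivity)
  have hB : (Bm : ℝ) * 2 ^ (dim c n - M) ≤ 2 ^ (c / η + 1) * (n : ℝ) ^ e := by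
    have h1 : (Bm : ℝ) * (n : ℝ) ^ (1 - η) ≤ n * 2 ^ (M - h') := by
      refine le_trans ?_ (show (Bm : ℝ) * (⌊(n : ℝ) ^ (1 - η)⌋₊ + 1) ≤ n * 2 ^ (M - h') by
        exact_mod_cast hBm)
      gcongr
      exact (Nat.lt_floor_add_one _).le
    -- The block length M cancels between the number of bitmaps and the size of each.
    have h2 : (2 : ℝ) ^ (M - h') * 2 ^ (dim c n - M) ≤ 2 ^ (c / η + 1) * (n : ℝ) ^ (c - κ) := by
      rw [← pow_add, show M - h' + (dim c n - M) = dim c n - h' by omega]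
      refine two_pow_le hn ?_
      rw [Nat.cast_sub (hh'M.trans hm₂d)]
      linarith
    have h3 : (Bm : ℝ) ≤ (n : ℝ) ^ η * 2 ^ (M - h') := by
      have hp : (0 : ℝ) < (n : ℝ) ^ (1 - η) := by positivity
      refine le_of_mul_le_mul_right (h1.trans_eq ?_) hp
      have : (n : ℝ) ^ η * (n : ℝ) ^ (1 - η) = n := by
        rw [← Real.rpow_add hn0]; simp
      calc (n : ℝ) * 2 ^ (M - h') = ((n : ℝ) ^ η * (n : ℝ) ^ (1 - η)) * 2 ^ (M - h') := by rw [this]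
        _ = _ := by ring
    calc (Bm : ℝ) * 2 ^ (dim c n - M) ≤ (n : ℝ) ^ η * 2 ^ (M - h') * 2 ^ (dim c n - M) := by gcongr
      _ = (n : ℝ) ^ η * (2 ^ (M - h') * 2 ^ (dim c n - M)) := by ring
      _ ≤ (n : ℝ) ^ η * (2 ^ (c / η + 1) * (n : ℝ) ^ (c - κ)) := by gcongr
      _ = 2 ^ (c / η + 1) * (n : ℝ) ^ e := by
        rw [he, Real.rpow_add hn0]; ring
  have hs' : (s : ℝ) ≤ 4 + (N + 1) * (2 * dim c n + 3) + n + N * (2 * 2 ^ M) +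
      n * 2 ^ (M - h') + Bm * 2 ^ (dim c n - M) := by exact_mod_cast hs
  refine hs'.trans ?_
  have h1 : ((N : ℝ) + 1) * (2 * dim c n + 3) ≤
      (N + 1) * (2 * (c * (n : ℝ) ^ e) + 3 * (n : ℝ) ^ e) := by
    gcongr
    linarith
  have h2 : (N : ℝ) * (2 * 2 ^ M) ≤ N * (2 * (n : ℝ) ^ e) := by gcongr
  linarith

/-- The number of steps of a query. -/
theorem time_le {c x η : ℝ} (hc : 1 < c) (hη : 0 < η) (hx : x ∈ sparseThresholds c) (N : ℕ) :
    ∃ δ : ℝ, 0 < δ ∧ ∃ A : ℝ, 0 < A ∧ ∀ n : ℕ, 1 ≤ n → ∀ F : ℕ,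
      F ≤ (⌊x * Real.logb 2 n⌋₊ + 1) * (dim c n).choose ⌊x * Real.logb 2 n⌋₊ →
      (((N + 1) * (130 * (dim c n + 1)) + 20 * F + N * (20 * ⌊(n : ℝ) ^ (1 - η)⌋₊) + 20 : ℕ) : ℝ) ≤
        A * (n : ℝ) ^ (1 - δ) := by
  obtain ⟨δ₀, hδ₀, C₀, hC₀, h₀⟩ := sparseThresholds_bound hx
  -- The three terms serve the sparse list with its factor t + 1, the lists of length at most L, and
  -- the O(d) address computations.
  have hδpos : 0 < min (min (δ₀ / 2) η) (1 / 2) := by positivity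
  set δ := min (min (δ₀ / 2) η) (1 / 2) with hδ
  have hδ1 : δ ≤ δ₀ / 2 := (min_le_left _ _).trans (min_le_left _ _)
  have hδ2 : δ ≤ η := (min_le_left _ _).trans (min_le_right _ _)
  have hδ3 : δ ≤ 1 / 2 := min_le_right _ _
  obtain ⟨C₁, hC₁, h₁⟩ := exists_logb_le (show 0 < δ₀ / 2 by positivity)
  obtain ⟨C₂, hC₂, h₂⟩ := exists_logb_le (show (0 : ℝ) < 1 / 2 by norm_num)
  have hx0 := hx.1
  have hc0 : 0 < c := by linarith
  refine ⟨δ, hδpos, (N + 1) * (130 * (c * C₂ + 1)) + 20 * ((x * C₁ + 1) * C₀) + N * 20 + 20,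
    by positivity, fun n hn F hF => ?_⟩
  have hn1 : (1 : ℝ) ≤ n := by exact_mod_cast hn
  have hn0 : (0 : ℝ) < n := by linarith
  have hpow : ∀ y : ℝ, y ≤ 1 - δ → (n : ℝ) ^ y ≤ (n : ℝ) ^ (1 - δ) := fun y hy =>
    Real.rpow_le_rpow_of_exponent_le hn1 hy
  have hone : (1 : ℝ) ≤ (n : ℝ) ^ (1 - δ) := by simpa using hpow 0 (by linarith)
  have hd : (dim c n : ℝ) ≤ c * C₂ * (n : ℝ) ^ (1 - δ) := by
    refine (dim_le hc0.le hn).trans ?_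
    rw [mul_assoc]
    gcongr
    exact (h₂ n hn).trans (mul_le_mul_of_nonneg_left (hpow (1 / 2) (by linarith)) hC₂)
  have hL : (⌊(n : ℝ) ^ (1 - η)⌋₊ : ℝ) ≤ (n : ℝ) ^ (1 - δ) :=
    (Nat.floor_le (by positivity)).trans (hpow _ (by linarith))
  have ht : (⌊x * Real.logb 2 n⌋₊ : ℝ) + 1 ≤ (x * C₁ + 1) * (n : ℝ) ^ (δ₀ / 2) := by
    have h3 := Nat.floor_le (mul_nonneg hx0.le (logb_nonneg hn))
    have h4 : x * Real.logb 2 n ≤ x * (C₁ * (n : ℝ) ^ (δ₀ / 2)) := by gcongr; exact h₁ n hn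
    have h5 : (1 : ℝ) ≤ (n : ℝ) ^ (δ₀ / 2) := Real.one_le_rpow hn1 (by positivity)
    linarith
  have hF' : (F : ℝ) ≤ (x * C₁ + 1) * C₀ * (n : ℝ) ^ (1 - δ) := by
    have h3 : (F : ℝ) ≤ (⌊x * Real.logb 2 n⌋₊ + 1) * (dim c n).choose ⌊x * Real.logb 2 n⌋₊ := by
      exact_mod_cast hF
    calc (F : ℝ) ≤ (x * C₁ + 1) * (n : ℝ) ^ (δ₀ / 2) * (C₀ * (n : ℝ) ^ (1 - δ₀)) :=
          h3.trans (mul_le_mul ht (h₀ n hn) (by positivity) (by positivity))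
      _ = (x * C₁ + 1) * C₀ * (n : ℝ) ^ (1 - δ₀ / 2) := by
        rw [show 1 - δ₀ / 2 = δ₀ / 2 + (1 - δ₀) by ring, Real.rpow_add hn0]; ring
      _ ≤ _ := mul_le_mul_of_nonneg_left (hpow (1 - δ₀ / 2) (by linarith)) (by positivity)
  push_cast
  have h6 : ((N : ℝ) + 1) * (130 * (dim c n + 1)) ≤
      (N + 1) * (130 * (c * C₂ * (n : ℝ) ^ (1 - δ) + (n : ℝ) ^ (1 - δ))) := by gcongr
  have h7 : (N : ℝ) * (20 * ⌊(n : ℝ) ^ (1 - η)⌋₊) ≤ N * (20 * (n : ℝ) ^ (1 - δ)) := by gcongr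
  linarith

theorem logb_le_natLog_add_one {n : ℕ} (hn : 1 ≤ n) : Real.logb 2 n ≤ Nat.log 2 n + 1 := by
  rw [Real.logb_le_iff_le_rpow (by norm_num) (by exact_mod_cast hn)]
  exact_mod_cast (Nat.lt_pow_succ_log_self (by norm_num) n).le

theorem natLog_le_logb {n : ℕ} (hn : 1 ≤ n) : (Nat.log 2 n : ℝ) ≤ Real.logb 2 n := by
  rw [Real.le_logb_iff_rpow_le (by norm_num) (by exact_mod_cast hn), Real.rpow_natCast]
  exact_mod_cast Nat.pow_log_le_self 2 (by omega)

/-- For a suitable constant `K`, the words are long enough for vectors and addresses. -/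
theorem exists_wordSize {c A e : ℝ} (hc : 0 < c) :
    ∃ K : ℕ, ∀ n : ℕ, 1 ≤ n → dim c n ≤ wordSize K n ∧ 0 < wordSize K n ∧
      ∀ s : ℕ, (s : ℝ) ≤ A * (n : ℝ) ^ e → s < 2 ^ wordSize K n := by
  obtain ⟨k, hk⟩ := pow_unbounded_of_one_lt A (show (1 : ℝ) < 2 by norm_num)
  -- With p = 2^(⌊log n⌋+1) ≥ max(n, 2), the number of words is p^K: the summand k covers the
  -- constant A, ⌈e⌉ the factor n^e, and ⌈c⌉ the bits of a vector.
  refine ⟨k + ⌈e⌉₊ + ⌈c⌉₊, fun n hn => ⟨?_, ?_, fun s hs => ?_⟩⟩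
  · have h1 := dim_le hc.le hn
    have h2 := logb_le_natLog_add_one hn
    have h3 : (dim c n : ℝ) ≤ (⌈c⌉₊ * (Nat.log 2 n + 1) : ℕ) := by
      push_cast
      exact h1.trans (mul_le_mul (Nat.le_ceil c) h2 (logb_nonneg hn) (by positivity))
    exact (Nat.cast_le.1 h3).trans (Nat.mul_le_mul_right _ (by omega))
  · have := Nat.ceil_pos.2 hc
    exact Nat.mul_pos (by omega) (by omega)
  · have hn1 : (1 : ℝ) ≤ n := by exact_mod_cast hn
    set p : ℝ := 2 ^ (Nat.log 2 n + 1) with hp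
    have hnp : (n : ℝ) ≤ p := by
      rw [hp]; exact_mod_cast (Nat.lt_pow_succ_log_self (by norm_num) n).le
    have h2p : (2 : ℝ) ≤ p := by
      rw [hp, pow_succ]
      have : (1 : ℝ) ≤ 2 ^ Nat.log 2 n := one_le_pow₀ (by norm_num)
      linarith
    have h1 : (n : ℝ) ^ e ≤ p ^ ⌈e⌉₊ := by
      refine (Real.rpow_le_rpow_of_exponent_le hn1 (Nat.le_ceil e)).trans ?_
      rw [Real.rpow_natCast]
      gcongr
    have h2 : A < p ^ k := hk.trans_le (by gcongr)
    have h3 : (s : ℝ) < 2 ^ wordSize (k + ⌈e⌉₊ + ⌈c⌉₊) n := by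
      have hn0 : (0 : ℝ) < (n : ℝ) ^ e := by positivity
      calc (s : ℝ) ≤ A * (n : ℝ) ^ e := hs
        _ < p ^ k * (n : ℝ) ^ e := by gcongr
        _ ≤ p ^ k * p ^ ⌈e⌉₊ := by gcongr
        _ = p ^ (k + ⌈e⌉₊) := (pow_add _ _ _).symm
        _ ≤ p ^ (k + ⌈e⌉₊ + ⌈c⌉₊) := pow_le_pow_right₀ (by linarith) (Nat.le_add_right _ _)
        _ = _ := by rw [hp, ← pow_mul, wordSize, mul_comm]
    exact_mod_cast h3

end OVIndexing

/-! ### The theorem -/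

theorem mainTheorem1 (c c₁ ε : ℝ) (hc : 1 < c)
    (hc₁ : IsLUB (OVIndexing.sparseThresholds c) c₁)
    (hε : 0 < ε) (hε' : ε ≤ max c₁ (c - 1)) :
    ∃ x ∈ OVIndexing.sparseThresholds c, ∃ η : ℝ, 0 < η ∧ ∃ γ : ℝ, 0 < γ ∧
    ∃ (P : WordRAM.Cmd) (K : ℕ) (δ : ℝ), 0 < δ ∧ ∃ C : ℝ,
      ∀ n : ℕ, 1 ≤ n → ∀ S : Finset (OVIndexing.Vec (OVIndexing.dim c n)), S.card = n →
        ∃ (s : ℕ) (mem : Fin s → BitVec (WordRAM.wordSize K n)),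
          OVIndexing.HoldsDivideByOnes
            ⌊x * Real.logb 2 n⌋₊ ⌊η * Real.logb 2 n⌋₊ ⌊c / η⌋₊ ⌊(c - 1) / η⌋₊
            ⌊(n : ℝ) ^ (1 - γ)⌋₊ S mem ∧
          ((s * WordRAM.wordSize K n : ℕ) : ℝ) ≤
            C * (n : ℝ) ^ (c - (c₁ - ε) / c * (c - 1 - ε)) ∧
          ∀ u : OVIndexing.Vec (OVIndexing.dim c n),
            ∃ (σ : WordRAM.State (WordRAM.wordSize K n) s) (T : ℕ),
              WordRAM.Exec P (OVIndexing.startState mem u) σ T ∧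
              (T : ℝ) ≤ C * (n : ℝ) ^ (1 - δ) ∧
              (σ.reg 0 ≠ 0 ↔ ∃ v ∈ S, OVIndexing.Orthogonal v u) := by
  obtain ⟨x, hx, η, hη, hηx, hηc, hgap⟩ := OVIndexing.exists_parameters hc hc₁ hε hε'
  have hc0 : 0 < c := by linarith
  obtain ⟨A, hA, hsize⟩ := OVIndexing.size_le hc hη hηx hηc
    (OVIndexing.le_one_of_mem_sparseThresholds hx) hx.2.1
  obtain ⟨δ, hδ, A', hA', htime⟩ :=
    OVIndexing.time_le hc hη hx (⌊c / η⌋₊.choose ⌊(c - 1) / η⌋₊)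
  set e := c - (c - 1 - η) / c * (x - η) + η with he
  set e' := c - (c₁ - ε) / c * (c - 1 - ε) with he'
  obtain ⟨K, hK⟩ := OVIndexing.exists_wordSize (A := A) (e := e) hc0
  -- The gap e' - e > 0 from the choice of parameters absorbs the word length when words are
  -- converted to bits.
  obtain ⟨C₀, hC₀, hlog⟩ := OVIndexing.exists_logb_le (show 0 < e' - e by linarith)
  refine ⟨x, hx, η, hη, η, hη, WordRAM.evalArrays, K, δ, hδ, max (A * (K * (C₀ + 1))) A',
    fun n hn S hS => ?_⟩
  have hn1 : (1 : ℝ) ≤ n := by exact_mod_cast hn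
  have hn0 : (0 : ℝ) < n := by linarith
  obtain ⟨hdw, hw, hsw⟩ := hK n hn
  obtain ⟨s, Bm, hBm, hs, hmem⟩ := OVIndexing.exists_divideByOnes
    (t := ⌊x * Real.logb 2 n⌋₊) (L := ⌊(n : ℝ) ^ (1 - η)⌋₊)
    (OVIndexing.blocks_le_dim hc0.le hη hn)
    (show ⌊(c - 1) / η⌋₊ ≤ ⌊c / η⌋₊ from Nat.floor_le_floor (by gcongr; linarith)) S
  rw [hS] at hBm hs
  have hsA := hsize n hn s Bm hBm hs
  obtain ⟨mem, hdiv, hrun⟩ := hmem _ (hsw s hsA) hdw hw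
  refine ⟨s, mem, hdiv, ?_, fun u => ?_⟩
  · have hword : (WordRAM.wordSize K n : ℝ) ≤ K * ((C₀ + 1) * (n : ℝ) ^ (e' - e)) := by
      have h1 := (OVIndexing.natLog_le_logb hn).trans (hlog n hn)
      have h2 : (1 : ℝ) ≤ (n : ℝ) ^ (e' - e) := Real.one_le_rpow hn1 (by linarith)
      rw [WordRAM.wordSize]
      push_cast
      gcongr
      linarith
    calc ((s * WordRAM.wordSize K n : ℕ) : ℝ) = s * WordRAM.wordSize K n := by push_cast; rfl
      _ ≤ A * (n : ℝ) ^ e * (K * ((C₀ + 1) * (n : ℝ) ^ (e' - e))) := by gcongr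
      _ = A * (K * (C₀ + 1)) * (n : ℝ) ^ e' := by
        have : (n : ℝ) ^ e' = (n : ℝ) ^ e * (n : ℝ) ^ (e' - e) := by
          rw [← Real.rpow_add hn0, add_sub_cancel]
        rw [this]
        ring
      _ ≤ _ := by gcongr; exact le_max_left _ _
  · obtain ⟨σ, T, hexec, hT, hσ⟩ := hrun u
    refine ⟨σ, T, hexec, ?_, hσ⟩
    refine (Nat.cast_le.2 hT).trans ((htime n hn _
      (OVIndexing.card_fewOnes_le (OVIndexing.two_mul_floor_le_dim hx.2.1 hn) S)).trans ?_)
    gcongr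
    exact le_max_right _ _
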